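/- Let $X\subset\mathbb R^d$ be a compact convex set with non-empty interior, let $\lambda$ be Lebesgue measure, and let $V,L>0$. Let $\ell_1,\ell_2,\dots:X\to\mathbb R$ be any fixed stream of loss functions with $|\ell_t(x)|\le V$ and $|\ell_t(x')-\ell_t(x)|\le L\|x'-x\|$ for all $x,x'\in X$. Bandit Dual Averaging (Hedge variant) with parameters $\eta_t,\delta_t>0$ and $\varepsilon_t\in(0,1]$ starts from $y_1=0$ and, in each round $t=1,2,\dots$, 1. forms the density $\pi_t=(1-\varepsilon_t)\,\dfrac{e^{\eta_t y_t}}{\int_X e^{\eta_t y_t}\,d\lambda}+\dfrac{\varepsilon_t}{\lambda(X)}$ on $X$; 2. draws $x_t\sim\pi_t$, conditionally on the past, and observes only $\ell_t(x_t)$; 3. forms the loss model $\hat\ell_t(x)=\dfrac{\mathbf 1\{\|x-x_t\|\le\delta_t\}}{\lambda(N_{\delta_t}(x))}\cdot\dfrac{\ell_t(x_t)}{\pi_t(x_t)}$ for $x\in X$, where $N_\delta(x)=\{x'\in X:\|x'-x\|\le\delta\}$, and sets $y_{t+1}=y_t-\hat\ell_t$. (In particular, no explicit discretization of $X$ is used.)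 Let $$\mathrm{Reg}(T)=\max_{x\in X}\sum_{t=1}^T\Big[\int_X\ell_t\,\pi_t\,d\lambda-\ell_t(x)\Big].$$ Let $\eta_t=\eta_0t^{-p}$, $\delta_t=\delta_0t^{-w}$, $\varepsilon_t=\varepsilon_0t^{-b}$ with $\eta_0,\delta_0>0$, $\varepsilon_0\in(0,1]$ and $p,w,b\ge0$. Then there is a constant $K$ that depends only on $X,V,L,\eta_0,\delta_0,\varepsilon_0,p,w,b$ (neither on the losses nor on $T$) such that for all $T\ge1$ $$\mathbb E[\mathrm{Reg}(T)]\le K\big(T^{p}(1+\log T)+T^{1-w}+T^{1-b}+T^{1+dw+b-p}\big).$$ In particular, $p=\frac{d+2}{d+3}$ and $w=b=\frac1{d+3}$ give, for a constant $K$ of the same kind, $$\mathbb E[\mathrm{Reg}(T)]\le K\,T^{\frac{d+2}{d+3}}(1+\log T),$$ that is, $O(T^{(d+2)/(d+3)})$ up to a logarithmic factor. -/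

import Mathlib

open MeasureTheory

namespace BanditDA

noncomputable section

/-- The action set `X` is a subset of Euclidean space `ℝᵈ`. As a type, `X` carries the Euclidean
distance of `ℝᵈ`. -/
abbrev Euc (d : ℕ) : Type := EuclideanSpace ℝ (Fin d)

variable {d : ℕ} {X : Set (Euc d)}

/-- Lebesgue measure on `X`, as a measure on the subtype: `leb X B` is the volume of `B ⊆ X`
in `ℝᵈ`. -/
def leb (X : Set (Euc d)) : Measure X :=
  (volume : Measure (Euc d)).comap Subtype.val

/-- The logit map of Hedge: the density `exp (y x) / ∫_X exp y` on `X`. -/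
def logit (y : X → ℝ) (x : X) : ℝ :=
  Real.exp (y x) / ∫ z : X, Real.exp (y z) ∂(leb X)

/-- The uniform-ball kernel of radius `r`: `1{‖x' - x‖ ≤ r} / λ(N_r(x))`, where
`N_r(x)` is the closed ball of radius `r` around `x`, intersected with `X`. -/
def ballKernel (r : ℝ) (x x' : X) : ℝ :=
  (Metric.closedBall x r).indicator
    (fun _ => ((leb X).real (Metric.closedBall x r))⁻¹) x'

/-- The (density of the) mixed strategy with explicit exploration:
`(1 - e) * logit (c y) + e / λ(X)`. -/
def mixedStrategy (c e : ℝ) (y : X → ℝ) (x : X) : ℝ :=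
  (1 - e) * logit (fun z => c * y z) x + e / (leb X).real Set.univ

/-- The loss model built from the single observation `l a` of the loss function `l` at the
action `a`, drawn from the density `q`. For every `x`, it is an importance-weighted estimate
of the average of `l` over the neighborhood `N_r(x)`. -/
def lossModel (r : ℝ) (q l : X → ℝ) (a : X) (x : X) : ℝ :=
  ballKernel r x a * (l a / q a)

/-- The scores of bandit dual averaging after the actions `a 0, …, a (t - 1)`, with losses `ℓ`,
learning rates `η`, kernel radii `δ` and exploration weights `ε`.
The rounds are indexed by `0, 1, 2, …`. -/
def score (ℓ : ℕ → X → ℝ) (η δ ε : ℕ → ℝ) (a : ℕ → X) : ℕ → X → ℝ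
  | 0 => fun _ => 0
  | t + 1 => fun x =>
      score ℓ η δ ε a t x
        - lossModel (δ t) (mixedStrategy (η t) (ε t) (score ℓ η δ ε a t)) (ℓ t) (a t) x

/-- The density of the mixed strategy of bandit dual averaging in round `t`.
It depends on the actions `a 0, …, a (t - 1)` only. -/
def policy (ℓ : ℕ → X → ℝ) (η δ ε : ℕ → ℝ) (a : ℕ → X) (t : ℕ) : X → ℝ :=
  mixedStrategy (η t) (ε t) (score ℓ η δ ε a t)

/-- The random actions `a 0, a 1, …` are generated by bandit dual averaging: conditionally on the
actions before round `t`, the action of round `t` is drawn from the density `policy … t`. -/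
structure IsPlay {Ω : Type*} [MeasurableSpace Ω] (P : Measure Ω) (ℓ : ℕ → X → ℝ)
    (η δ ε : ℕ → ℝ) (a : ℕ → Ω → X) : Prop where
  measurable : ∀ t, Measurable (a t)
  condLaw : ∀ (t : ℕ) (B : Set X), MeasurableSet B →
    P[(a t ⁻¹' B).indicator (fun _ => (1 : ℝ)) |
        MeasurableSpace.comap (fun ω (s : Fin t) => a s ω) inferInstance]
      =ᵐ[P] fun ω => ∫ x in B, policy ℓ η δ ε (fun s => a s ω) t x ∂(leb X)

/-- The regret over the first `T` rounds of the policies with densities `π t` against the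
pure strategy `x`. -/
def regretAgainst (ℓ π : ℕ → X → ℝ) (T : ℕ) (x : X) : ℝ :=
  ∑ t ∈ Finset.range T, ((∫ z : X, ℓ t z * π t z ∂(leb X)) - ℓ t x)

/-- The static regret over the first `T` rounds. -/
def regret (ℓ π : ℕ → X → ℝ) (T : ℕ) : ℝ :=
  ⨆ x : X, regretAgainst ℓ π T x

/-- The sequence `c / τ ^ p` over the rounds `τ = 1, 2, …`; round `τ = t + 1` has index `t`. -/
def polyDecay (c p : ℝ) (t : ℕ) : ℝ :=
  c * ((t : ℝ) + 1) ^ (-p)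

/-- The static regret over `T` rounds of bandit dual averaging along the realized actions `a`. -/
def bdaRegret (ℓ : ℕ → X → ℝ) (η δ ε : ℕ → ℝ) (a : ℕ → X) (T : ℕ) : ℝ :=
  regret ℓ (policy ℓ η δ ε a) T

/-- `BoundedExpectedRegret X V L η δ ε F`: for every loss stream on `X` that is bounded by `V` and
`L`-Lipschitz, the expected static regret of bandit dual averaging after `T` rounds is `O(F T)`,
with a constant that depends neither on the losses nor on `T`. -/
def BoundedExpectedRegret.{u} (X : Set (Euc d)) (V L : ℝ) (η δ ε : ℕ → ℝ) (F : ℕ → ℝ) : Prop :=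
  ∃ K : ℝ, 0 < K ∧
    ∀ (ℓ : ℕ → X → ℝ), (∀ t x, |ℓ t x| ≤ V) → (∀ t x x', |ℓ t x' - ℓ t x| ≤ L * dist x' x) →
    ∀ (Ω : Type u) [MeasurableSpace Ω] (P : Measure Ω) [IsProbabilityMeasure P]
      (a : ℕ → Ω → X), IsPlay P ℓ η δ ε a →
    ∀ T : ℕ, 1 ≤ T →
      Integrable (fun ω => bdaRegret ℓ η δ ε (fun t => a t ω) T) P ∧
      ∫ ω, bdaRegret ℓ η δ ε (fun t => a t ω) T ∂P ≤ K * F T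

end

end BanditDA

/-!
Write `λ` for Lebesgue measure on `X`, `y t` for the scores, `z t` for the loss model of round `t`,
and `Λ t` for the Gibbs density `exp (η t * y t) / ∫ exp (η t * y t)`, so that the policy of round
`t` is `(1 - ε t) Λ t + ε t / λ(X)`.

*Hedge on the loss models.* Along every sequence of actions, consider the potential
`(η t)⁻¹ log (mean of exp (η t * y t))`. Passing from `y t` to `y (t + 1)` changes it by at most
`-∫ z t Λ t + e ^ M η t ∫ (z t)² Λ t` if `η t |z t| ≤ M` (`log_integral_exp_sub_le`). Passing from
`η t` to `η (t + 1) ≤ η t` does not increase it, by the power mean inequality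
(`log_average_exp_div_mono`). By Jensen's inequality the final potential is at least the mean of the
final score over any set `S`, minus `log (λ(X) / λ(S)) / η T` (`setAverage_sub_log_le`). This bounds
the regret on the loss models against the uniform distribution on `S` (`hedge_regret_le`). Here `S`
is a ball of radius of order `1 / T` around the comparator: by convexity it contains a copy of `X`
scaled by `1 / T` (`pow_mul_leb_le_leb_closedBall`), so that the entropy is at most `d log T`.

*From the loss models to the losses.* Conditionally on the past, the mean of `z t` at `x` is the
average of `ℓ t` over the ball around `x`, hence within `L δ t` of `ℓ t x`
(`abs_integral_lossModel_sub_le`), and its second moment is at most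
`V² λ(X) / (ε t * min λ(ball))`, of order `1 / (ε t * (δ t) ^ d)` (`integral_lossModel_sq_le`).
Integrating out the action of round `t` given the past (`IsPlay.integral_past_eq`) therefore turns
the regret of Hedge into the true expected regret, up to the bias, the exploration cost `2 V ε t`
and the second-order term (`IsPlay.integral_regretAgainst_le`).

*Rates.* Since the losses are fixed in advance, the supremum over comparators commutes with the
expectation (`IsPlay.integral_bdaRegret_le`), and it remains to sum powers of `τ`
(`exists_sum_rpow_neg_le`). The bound `η t |z t| ≤ M` holds when `d w + b ≤ p`; when `d w + b > p`
the term `T ^ (1 + d w + b - p)` exceeds `T`, and the regret is trivially at most `2 V T`.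
-/

open MeasureTheory

namespace BanditDA

/-! ### Lebesgue measure of balls in a convex body -/

lemma leb_apply {d : ℕ} {X : Set (Euc d)} (hX : IsCompact X) (B : Set X) :
    leb X B = volume (Subtype.val '' B) :=
  comap_subtype_coe_apply hX.measurableSet _ B

lemma leb_univ {d : ℕ} {X : Set (Euc d)} (hX : IsCompact X) : leb X Set.univ = volume X := by
  rw [leb_apply hX, Set.image_univ, Subtype.range_coe]

lemma isFiniteMeasure_leb {d : ℕ} {X : Set (Euc d)} (hX : IsCompact X) :
    IsFiniteMeasure (leb X) :=
  ⟨by rw [leb_univ hX]; exact hX.measure_lt_top⟩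

lemma leb_ne_zero {d : ℕ} {X : Set (Euc d)} (hX : IsCompact X) (hint : (interior X).Nonempty) :
    leb X ≠ 0 := by
  intro h
  have h1 : volume X = 0 := by rw [← leb_univ hX, h]; rfl
  exact (Measure.measure_pos_of_nonempty_interior volume hint).ne' h1

/-- In a convex set of diameter at most `D`, the ball of radius `r ≥ s * D` around `x` contains
the image of the set under the homothety with center `x` and ratio `s`. -/
lemma pow_mul_leb_le_leb_closedBall {d : ℕ} {X : Set (Euc d)} (hX : IsCompact X)
    (hconv : Convex ℝ X) {D : ℝ} (hD : ∀ x ∈ X, ∀ y ∈ X, dist x y ≤ D) {s r : ℝ}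
    (hs0 : 0 ≤ s) (hs1 : s ≤ 1) (hsr : s * D ≤ r) (x : X) :
    s ^ d * (leb X).real Set.univ ≤ (leb X).real (Metric.closedBall x r) := by
  have hsub : AffineMap.homothety (x : Euc d) s '' X
      ⊆ Subtype.val '' (Metric.closedBall x r) := by
    rintro _ ⟨z, hz, rfl⟩
    have hmem : AffineMap.homothety (x : Euc d) s z ∈ X := by
      rw [AffineMap.homothety_eq_lineMap]
      exact hconv.lineMap_mem x.2 hz ⟨hs0, hs1⟩
    refine ⟨⟨_, hmem⟩, ?_, rfl⟩
    rw [Metric.mem_closedBall, Subtype.dist_eq, dist_homothety_center, Real.norm_of_nonneg hs0]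
    exact (mul_le_mul_of_nonneg_left (hD _ x.2 _ hz) hs0).trans hsr
  have hfin := isFiniteMeasure_leb hX
  have h := measure_mono (μ := volume) hsub
  rw [Measure.addHaar_image_homothety, ← leb_apply hX, ← leb_univ hX, finrank_euclideanSpace,
    Fintype.card_fin, abs_of_nonneg (pow_nonneg hs0 d)] at h
  have h2 := ENNReal.toReal_mono (measure_ne_top _ _) h
  rwa [ENNReal.toReal_mul, ENNReal.toReal_ofReal (pow_nonneg hs0 d)] at h2

/-! ### Bounded measurable functions -/

/-- A measurable real function with a uniform bound. -/
structure BddMeas {α : Type*} [MeasurableSpace α] (f : α → ℝ) : Prop where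
  measurable : Measurable f
  bdd : ∃ C, ∀ x, |f x| ≤ C

namespace BddMeas

variable {α β : Type*} [MeasurableSpace α] [MeasurableSpace β] {f g : α → ℝ}

lemma integrable (hf : BddMeas f) (μ : Measure α) [IsFiniteMeasure μ] : Integrable f μ := by
  obtain ⟨C, hC⟩ := hf.bdd
  exact Integrable.of_bound hf.measurable.aestronglyMeasurable C
    (Filter.Eventually.of_forall fun x => by simpa using hC x)

lemma const (c : ℝ) : BddMeas (fun _ : α => c) := ⟨measurable_const, |c|, fun _ => le_rfl⟩

lemma add (hf : BddMeas f) (hg : BddMeas g) : BddMeas (fun x => f x + g x) := by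
  obtain ⟨C, hC⟩ := hf.bdd
  obtain ⟨C', hC'⟩ := hg.bdd
  exact ⟨hf.measurable.add hg.measurable, C + C',
    fun x => (abs_add_le _ _).trans (add_le_add (hC x) (hC' x))⟩

lemma mul (hf : BddMeas f) (hg : BddMeas g) : BddMeas (fun x => f x * g x) := by
  obtain ⟨C, hC⟩ := hf.bdd
  obtain ⟨C', hC'⟩ := hg.bdd
  refine ⟨hf.measurable.mul hg.measurable, C * C', fun x => ?_⟩
  rw [abs_mul]
  exact mul_le_mul (hC x) (hC' x) (abs_nonneg _) ((abs_nonneg _).trans (hC x))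

lemma const_mul (c : ℝ) (hf : BddMeas f) : BddMeas (fun x => c * f x) := (const c).mul hf

lemma sub (hf : BddMeas f) (hg : BddMeas g) : BddMeas (fun x => f x - g x) := by
  have h := hf.add (hg.const_mul (-1))
  simpa [sub_eq_add_neg] using h

lemma sq (hf : BddMeas f) : BddMeas (fun x => f x ^ 2) := by
  simpa [pow_two] using hf.mul hf

lemma exp (hf : BddMeas f) : BddMeas (fun x => Real.exp (f x)) := by
  obtain ⟨C, hC⟩ := hf.bdd
  refine ⟨hf.measurable.exp, Real.exp C, fun x => ?_⟩
  rw [abs_of_pos (Real.exp_pos _)]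
  exact Real.exp_le_exp.2 ((le_abs_self _).trans (hC x))

lemma div (hf : BddMeas f) (hg : BddMeas g) {c : ℝ} (hc : 0 < c) (hgc : ∀ x, c ≤ g x) :
    BddMeas (fun x => f x / g x) := by
  obtain ⟨C, hC⟩ := hf.bdd
  refine ⟨hf.measurable.div hg.measurable, C / c, fun x => ?_⟩
  rw [abs_div, abs_of_pos (hc.trans_le (hgc x))]
  exact div_le_div₀ ((abs_nonneg _).trans (hC x)) (hC x) hc (hgc x)

lemma comp (hf : BddMeas f) {φ : β → α} (hφ : Measurable φ) : BddMeas (fun x => f (φ x)) := by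
  obtain ⟨C, hC⟩ := hf.bdd
  exact ⟨hf.measurable.comp hφ, C, fun x => hC _⟩

lemma fst (hf : BddMeas f) : BddMeas (fun p : α × β => f p.1) := hf.comp measurable_fst

lemma snd (hf : BddMeas f) : BddMeas (fun p : β × α => f p.2) := hf.comp measurable_snd

lemma swap {F : α × β → ℝ} (hF : BddMeas F) : BddMeas (fun p : β × α => F (p.2, p.1)) :=
  hF.comp measurable_swap

lemma slice {F : α × β → ℝ} (hF : BddMeas F) (x : α) : BddMeas (fun y => F (x, y)) :=
  hF.comp measurable_prodMk_left

lemma sum {ι : Type*} (s : Finset ι) {F : ι → α → ℝ} (hF : ∀ i ∈ s, BddMeas (F i)) :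
    BddMeas (fun x => ∑ i ∈ s, F i x) := by
  classical
  induction s using Finset.induction_on with
  | empty => simpa using const (α := α) 0
  | insert i s hi ih =>
    simp only [Finset.sum_insert hi]
    exact (hF i (by simp)).add (ih fun j hj => hF j (by simp [hj]))

lemma integral_right {F : α × β → ℝ} (hF : BddMeas F) (μ : Measure β) [IsFiniteMeasure μ] :
    BddMeas (fun x => ∫ y, F (x, y) ∂μ) := by
  obtain ⟨C, hC⟩ := hF.bdd
  refine ⟨(hF.measurable.stronglyMeasurable.integral_prod_right' (ν := μ)).measurable,
    C * μ.real Set.univ, fun x => ?_⟩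
  rw [← Real.norm_eq_abs]
  exact norm_integral_le_of_norm_le_const
    (Filter.Eventually.of_forall fun y => (Real.norm_eq_abs _).trans_le (hC (x, y)))

lemma integral_exp_ge {C : ℝ} (hf : BddMeas f) (hC : ∀ x, |f x| ≤ C) (μ : Measure α)
    [IsFiniteMeasure μ] : Real.exp (-C) * μ.real Set.univ ≤ ∫ x, Real.exp (f x) ∂μ := by
  calc Real.exp (-C) * μ.real Set.univ = ∫ _, Real.exp (-C) ∂μ := by
        rw [integral_const, smul_eq_mul, mul_comm]
    _ ≤ _ := integral_mono ((const _).integrable μ) (hf.exp.integrable μ)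
        fun x => Real.exp_le_exp.2 (neg_le_of_abs_le (hC x))

lemma integral_exp_pos (hf : BddMeas f) (μ : Measure α) [IsFiniteMeasure μ] [NeZero μ] :
    0 < ∫ x, Real.exp (f x) ∂μ := by
  obtain ⟨C, hC⟩ := hf.bdd
  exact (mul_pos (Real.exp_pos _) (by simp)).trans_le (hf.integral_exp_ge hC μ)

end BddMeas

/-! ### Hedge with decreasing learning rates -/

lemma exp_neg_le_of_abs_le {u M : ℝ} (h : |u| ≤ M) :
    Real.exp (-u) ≤ 1 - u + Real.exp M * u ^ 2 := by
  have hM : 1 ≤ Real.exp M := Real.one_le_exp ((abs_nonneg _).trans h)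
  rcases le_total |u| 1 with h1 | h1
  · have h2 := (abs_le.1 (Real.abs_exp_sub_one_sub_id_le (x := -u) (by simpa using h1))).2
    nlinarith [sq_nonneg u]
  · rcases le_total 0 u with h0 | h0
    · rw [abs_of_nonneg h0] at h1
      have : Real.exp (-u) ≤ 1 := Real.exp_le_one_iff.2 (by linarith)
      nlinarith
    · rw [abs_of_nonpos h0] at h h1
      have h2 : Real.exp (-u) ≤ Real.exp M := Real.exp_le_exp.2 h
      have h3 : 0 ≤ Real.exp M * (u ^ 2 - 1) := mul_nonneg (by linarith) (by nlinarith)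
      linarith

section Hedge

variable {α : Type*} [MeasurableSpace α] (μ : Measure α) [IsFiniteMeasure μ] [NeZero μ]

/-- One step of Hedge: the potential `log ∫ exp (c * y)` decreases by `c` times the mean of the
loss `z` under the Gibbs density, up to a second-order term. -/
lemma log_integral_exp_sub_le {y z : α → ℝ} (hy : BddMeas y) (hz : BddMeas z) {c M : ℝ}
    (hM : ∀ x, |c * z x| ≤ M) :
    Real.log (∫ x, Real.exp (c * (y x - z x)) ∂μ) ≤ Real.log (∫ x, Real.exp (c * y x) ∂μ)
      - c * ∫ x, z x * (Real.exp (c * y x) / ∫ x', Real.exp (c * y x') ∂μ) ∂μ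
      + Real.exp M * c ^ 2 *
        ∫ x, z x ^ 2 * (Real.exp (c * y x) / ∫ x', Real.exp (c * y x') ∂μ) ∂μ := by
  set Z := ∫ x, Real.exp (c * y x) ∂μ with hZ
  have hZpos : 0 < Z := (hy.const_mul c).integral_exp_pos μ
  have hWpos : 0 < ∫ x, Real.exp (c * (y x - z x)) ∂μ :=
    ((hy.sub hz).const_mul c).integral_exp_pos μ
  have hE : BddMeas fun x => Real.exp (c * y x) := (hy.const_mul c).exp
  have key : ∫ x, Real.exp (c * (y x - z x)) ∂μ ≤
      Z - c * ∫ x, z x * Real.exp (c * y x) ∂μ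
        + Real.exp M * c ^ 2 * ∫ x, z x ^ 2 * Real.exp (c * y x) ∂μ := by
    rw [hZ, ← integral_const_mul, ← integral_const_mul,
      ← integral_sub (hE.integrable μ) (((hz.mul hE).const_mul c).integrable μ),
      ← integral_add ((hE.sub ((hz.mul hE).const_mul c)).integrable μ)
        (((hz.sq.mul hE).const_mul _).integrable μ)]
    refine integral_mono (((hy.sub hz).const_mul c).exp.integrable μ)
      (((hE.sub ((hz.mul hE).const_mul c)).add ((hz.sq.mul hE).const_mul _)).integrable μ)
      fun x => ?_
    have h1 := exp_neg_le_of_abs_le (hM x)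
    have h2 : Real.exp (c * (y x - z x)) = Real.exp (c * y x) * Real.exp (-(c * z x)) := by
      rw [← Real.exp_add]; ring_nf
    calc Real.exp (c * (y x - z x))
        ≤ Real.exp (c * y x) * (1 - c * z x + Real.exp M * (c * z x) ^ 2) := by
          rw [h2]; exact mul_le_mul_of_nonneg_left h1 (Real.exp_pos _).le
      _ = _ := by ring
  have hlog := Real.log_le_sub_one_of_pos (div_pos hWpos hZpos)
  rw [Real.log_div hWpos.ne' hZpos.ne'] at hlog
  have hkey : (∫ x, Real.exp (c * (y x - z x)) ∂μ) / Z ≤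
      1 - c * ((∫ x, z x * Real.exp (c * y x) ∂μ) / Z)
        + Real.exp M * c ^ 2 * ((∫ x, z x ^ 2 * Real.exp (c * y x) ∂μ) / Z) := by
    rw [div_le_iff₀ hZpos]
    refine key.trans (le_of_eq ?_)
    field_simp
  have hdiv : ∀ f : α → ℝ, ∫ x, f x * (Real.exp (c * y x) / Z) ∂μ
      = (∫ x, f x * Real.exp (c * y x) ∂μ) / Z := fun f => by
    rw [← integral_div]; simp only [mul_div_assoc]
  rw [hdiv, hdiv fun x => z x ^ 2]
  linarith

/-- The potential `c⁻¹ * log (mean of exp (c * y))` is nondecreasing in `c`; this is the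
power mean inequality for `exp y`. -/
lemma log_average_exp_div_mono {y : α → ℝ} (hy : BddMeas y) {c c' : ℝ} (hc' : 0 < c')
    (hcc : c' ≤ c) :
    Real.log (⨍ x, Real.exp (c' * y x) ∂μ) / c' ≤ Real.log (⨍ x, Real.exp (c * y x) ∂μ) / c := by
  have hc : 0 < c := hc'.trans_le hcc
  have hpos : ∀ e : ℝ, 0 < ⨍ x, Real.exp (e * y x) ∂μ := fun e => by
    rw [average_eq]
    exact mul_pos (inv_pos.2 (by simp)) ((hy.const_mul e).integral_exp_pos μ)
  have hr : 1 ≤ c / c' := (one_le_div hc').2 hcc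
  have hpow : ∀ x, Real.exp (c' * y x) ^ (c / c') = Real.exp (c * y x) := fun x => by
    rw [← Real.exp_mul]; congr 1; field_simp
  have hJ := (convexOn_rpow hr).map_average_le (μ := μ) (f := fun x => Real.exp (c' * y x))
    (Real.continuous_rpow_const (by linarith)).continuousOn isClosed_Ici
    (Filter.Eventually.of_forall fun x => (Real.exp_pos _).le)
    ((hy.const_mul c').exp.integrable μ)
    (by simpa only [Function.comp_def, hpow] using (hy.const_mul c).exp.integrable μ)
  simp only [hpow] at hJ
  have h := Real.log_le_log (Real.rpow_pos_of_pos (hpos c') _) hJ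
  rw [Real.log_rpow (hpos c')] at h
  rw [div_le_div_iff₀ hc' hc]
  rw [div_mul_eq_mul_div, div_le_iff₀ hc'] at h
  linarith

/-- Lower bound on the potential by the mean score over a set `S`; the price is the
relative entropy `log (μ univ / μ S)` of the uniform distribution on `S`. -/
lemma setAverage_sub_log_le {y : α → ℝ} (hy : BddMeas y) (c : ℝ) {S : Set α}
    (hS : 0 < μ.real S) :
    c * (⨍ x in S, y x ∂μ) - Real.log (μ.real Set.univ / μ.real S)
      ≤ Real.log (⨍ x, Real.exp (c * y x) ∂μ) := by
  have hU : 0 < μ.real Set.univ := by simp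
  have hE : BddMeas fun x => Real.exp (c * y x) := (hy.const_mul c).exp
  have hS0 : μ S ≠ 0 := fun h => hS.ne' (by simp [measureReal_def, h])
  have hJ := convexOn_exp.map_set_average_le (μ := μ) (t := S) (f := fun x => c * y x)
    Real.continuous_exp.continuousOn isClosed_univ hS0 (measure_ne_top _ _)
    (Filter.Eventually.of_forall fun x => Set.mem_univ _)
    ((hy.const_mul c).integrable μ).integrableOn (hE.integrable μ).integrableOn
  have hcy : (⨍ x in S, c * y x ∂μ) = c * ⨍ x in S, y x ∂μ := by
    rw [setAverage_eq, setAverage_eq, integral_const_mul, smul_eq_mul, smul_eq_mul]; ring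
  rw [hcy] at hJ
  have hle : ∫ x in S, Real.exp (c * y x) ∂μ ≤ ∫ x, Real.exp (c * y x) ∂μ :=
    setIntegral_le_integral (hE.integrable μ)
      (Filter.Eventually.of_forall fun x => (Real.exp_pos _).le)
  rw [setAverage_eq μ (fun x => Real.exp (c * y x)), smul_eq_mul] at hJ
  rw [average_eq μ (fun x => Real.exp (c * y x)), smul_eq_mul]
  rw [Real.le_log_iff_exp_le (mul_pos (inv_pos.2 hU) ((hy.const_mul c).integral_exp_pos μ)),
    Real.exp_sub, Real.exp_log (div_pos hU hS), div_le_iff₀ (div_pos hU hS)]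
  refine hJ.trans ?_
  have : (μ.real Set.univ)⁻¹ * (∫ x, Real.exp (c * y x) ∂μ) * (μ.real Set.univ / μ.real S)
      = (μ.real S)⁻¹ * ∫ x, Real.exp (c * y x) ∂μ := by field_simp
  rw [this]
  exact mul_le_mul_of_nonneg_left hle (inv_nonneg.2 hS.le)

/-- Regret of Hedge on a stream of bounded losses `z`, against the uniform distribution on `S`. -/
theorem hedge_regret_le {y z : ℕ → α → ℝ} (hy0 : ∀ x, y 0 x = 0)
    (hy : ∀ t x, y (t + 1) x = y t x - z t x) (hz : ∀ t, BddMeas (z t)) {c : ℕ → ℝ}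
    (hc : ∀ t, 0 < c t) (hanti : Antitone c) {M : ℝ} (hM : ∀ t x, |c t * z t x| ≤ M)
    {S : Set α} (hS : 0 < μ.real S) (T : ℕ) :
    ∑ t ∈ Finset.range (T + 1),
      ((∫ x, z t x * (Real.exp (c t * y t x) / ∫ x', Real.exp (c t * y t x') ∂μ) ∂μ)
        - (⨍ x in S, z t x ∂μ)
        - Real.exp M * c t *
          ∫ x, z t x ^ 2 * (Real.exp (c t * y t x) / ∫ x', Real.exp (c t * y t x') ∂μ) ∂μ)
      ≤ Real.log (μ.real Set.univ / μ.real S) / c T := by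
  have hyB : ∀ t, BddMeas (y t) := by
    intro t
    induction t with
    | zero => rw [show y 0 = fun _ => 0 from funext hy0]; exact BddMeas.const 0
    | succ t ih => rw [show y (t + 1) = _ from funext (hy t)]; exact ih.sub (hz t)
  have hU : 0 < μ.real Set.univ := by simp
  have hsplit : ∀ e t, Real.log (⨍ x, Real.exp (e * y t x) ∂μ)
      = Real.log (∫ x, Real.exp (e * y t x) ∂μ) - Real.log (μ.real Set.univ) := fun e t => by
    rw [average_eq, smul_eq_mul, Real.log_mul (inv_ne_zero hU.ne')
      (((hyB t).const_mul e).integral_exp_pos μ).ne', Real.log_inv]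
    ring
  set A : ℕ → ℝ := fun t =>
    ∫ x, z t x * (Real.exp (c t * y t x) / ∫ x', Real.exp (c t * y t x') ∂μ) ∂μ with hA
  set Q : ℕ → ℝ := fun t =>
    ∫ x, z t x ^ 2 * (Real.exp (c t * y t x) / ∫ x', Real.exp (c t * y t x') ∂μ) ∂μ with hQ
  have hstep : ∀ t, Real.log (⨍ x, Real.exp (c t * y (t + 1) x) ∂μ) / c t ≤
      Real.log (⨍ x, Real.exp (c t * y t x) ∂μ) / c t - A t + Real.exp M * c t * Q t := by
    intro t
    have h := log_integral_exp_sub_le μ (hyB t) (hz t) (hM t)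
    simp_rw [← hy t] at h
    rw [hsplit, hsplit]
    have hct := hc t
    rw [div_le_iff₀ hct]
    have e : ∀ a A B : ℝ, (a / c t - A + B) * c t = a - c t * A + c t * B := fun a A B => by
      field_simp
    rw [e]
    have e2 : c t * (Real.exp M * c t * Q t) = Real.exp M * c t ^ 2 * Q t := by ring
    rw [e2]
    linarith
  have hpot : ∀ t, Real.log (⨍ x, Real.exp (c t * y (t + 1) x) ∂μ) / c t ≤
      ∑ s ∈ Finset.range (t + 1), (- A s + Real.exp M * c s * Q s) := by
    intro t
    induction t with
    | zero =>
      have h := hstep 0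
      have h0 : Real.log (⨍ x, Real.exp (c 0 * y 0 x) ∂μ) = 0 := by
        simp [hy0]
      rw [h0, zero_div] at h
      simp only [zero_add, Finset.sum_range_one] at h ⊢
      linarith
    | succ t ih =>
      rw [Finset.sum_range_succ]
      have h1 := hstep (t + 1)
      have h2 := log_average_exp_div_mono μ (hyB (t + 1)) (hc (t + 1)) (hanti (Nat.le_succ t))
      linarith
  have hyS : ∀ t, (⨍ x in S, y t x ∂μ) = - ∑ s ∈ Finset.range t, ⨍ x in S, z s x ∂μ := by
    intro t
    induction t with
    | zero => simp [hy0]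
    | succ t ih =>
      rw [Finset.sum_range_succ, neg_add, ← ih]
      simp only [setAverage_eq, hy]
      rw [integral_sub ((hyB t).integrable _) ((hz t).integrable _)]
      simp only [smul_eq_mul]
      ring
  have hlow := setAverage_sub_log_le μ (hyB (T + 1)) (c T) hS
  have h1 := hpot T
  rw [div_le_iff₀ (hc T)] at h1
  rw [hyS] at hlow
  rw [le_div_iff₀ (hc T)]
  have e : ∑ t ∈ Finset.range (T + 1), (A t - (⨍ x in S, z t x ∂μ) - Real.exp M * c t * Q t)
      = - ∑ t ∈ Finset.range (T + 1), (- A t + Real.exp M * c t * Q t)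
        - ∑ t ∈ Finset.range (T + 1), ⨍ x in S, z t x ∂μ := by
    rw [← Finset.sum_neg_distrib, ← Finset.sum_sub_distrib]
    exact Finset.sum_congr rfl fun t _ => by ring
  rw [e]
  linarith

end Hedge

/-! ### The one-point loss estimator -/

section Estimator

variable {d : ℕ} {X : Set (Euc d)}

lemma ballKernel_of_dist_le {r : ℝ} {x a : X} (h : dist a x ≤ r) :
    ballKernel r x a = ((leb X).real (Metric.closedBall x r))⁻¹ :=
  Set.indicator_of_mem (Metric.mem_closedBall.2 h) _

lemma ballKernel_of_lt_dist {r : ℝ} {x a : X} (h : r < dist a x) : ballKernel r x a = 0 :=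
  Set.indicator_of_notMem (by simpa using h) _

lemma ballKernel_nonneg (r : ℝ) (x a : X) : 0 ≤ ballKernel r x a :=
  Set.indicator_nonneg (fun _ _ => inv_nonneg.2 measureReal_nonneg) _

lemma ballKernel_le {r κ : ℝ} {x : X} (hκ : 0 < κ)
    (hball : κ ≤ (leb X).real (Metric.closedBall x r)) (a : X) : ballKernel r x a ≤ κ⁻¹ := by
  rcases le_or_gt (dist a x) r with h | h
  · rw [ballKernel_of_dist_le h]
    exact inv_anti₀ hκ hball
  · rw [ballKernel_of_lt_dist h]
    exact (inv_pos.2 hκ).le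

lemma integral_ballKernel {r : ℝ} {x : X} (hball : 0 < (leb X).real (Metric.closedBall x r)) :
    ∫ a, ballKernel r x a ∂(leb X) = 1 := by
  unfold ballKernel
  rw [integral_indicator Metric.isClosed_closedBall.measurableSet, setIntegral_const,
    smul_eq_mul, mul_inv_cancel₀ hball.ne']

lemma measurable_ballKernel [IsFiniteMeasure (leb X)] (r : ℝ) :
    Measurable fun p : X × X => ballKernel r p.1 p.2 := by
  have hs : MeasurableSet {p : X × X | dist p.2 p.1 ≤ r} :=
    measurableSet_le (measurable_snd.dist measurable_fst) measurable_const
  have hm : Measurable fun x : X => ((leb X).real (Metric.closedBall x r))⁻¹ :=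
    (measurable_measure_prodMk_left (ν := leb X) hs).ennreal_toReal.inv
  exact (hm.comp measurable_fst).indicator hs

lemma bddMeas_ballKernel [IsFiniteMeasure (leb X)] {r κ : ℝ} (hκ : 0 < κ)
    (hball : ∀ x : X, κ ≤ (leb X).real (Metric.closedBall x r)) :
    BddMeas fun p : X × X => ballKernel r p.1 p.2 :=
  ⟨measurable_ballKernel r, κ⁻¹, fun p => by
    rw [abs_of_nonneg (ballKernel_nonneg _ _ _)]
    exact ballKernel_le hκ (hball _) _⟩

/-- The loss model is measurable and bounded jointly in all data, when the sampling density and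
the sampled action depend measurably on a parameter. -/
lemma bddMeas_lossModel [IsFiniteMeasure (leb X)] {β : Type*} [MeasurableSpace β] {r κ θ : ℝ}
    (hκ : 0 < κ) (hball : ∀ x : X, κ ≤ (leb X).real (Metric.closedBall x r)) {l : X → ℝ}
    (hl : BddMeas l) {q : β → X → ℝ} (hq : BddMeas fun p : β × X => q p.1 p.2) (hθ : 0 < θ)
    (hqθ : ∀ b x, θ ≤ q b x) {φ : β → X} (hφ : Measurable φ) :
    BddMeas fun p : β × X => lossModel r (q p.1) l (φ p.1) p.2 := by
  have h1 := (bddMeas_ballKernel hκ hball).comp (φ := fun p : β × X => (p.2, φ p.1))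
    (measurable_snd.prodMk (hφ.comp measurable_fst))
  have h2 := hl.comp (φ := fun p : β × X => φ p.1) (hφ.comp measurable_fst)
  have h3 := hq.comp (φ := fun p : β × X => (p.1, φ p.1))
    (measurable_fst.prodMk (hφ.comp measurable_fst))
  exact h1.mul (h2.div h3 hθ fun p => hqθ _ _)

lemma abs_lossModel_le {r κ θ V : ℝ} (hκ : 0 < κ) {x : X}
    (hball : κ ≤ (leb X).real (Metric.closedBall x r)) {q l : X → ℝ} (hθ : 0 < θ)
    (hqθ : ∀ x, θ ≤ q x) (hV : ∀ x, |l x| ≤ V) (a : X) :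
    |lossModel r q l a x| ≤ V / (κ * θ) := by
  have hV0 : 0 ≤ V := (abs_nonneg _).trans (hV a)
  unfold lossModel
  rw [abs_mul, abs_of_nonneg (ballKernel_nonneg _ _ _), abs_div,
    abs_of_pos (hθ.trans_le (hqθ a))]
  calc ballKernel r x a * (|l a| / q a) ≤ κ⁻¹ * (V / θ) :=
        mul_le_mul (ballKernel_le hκ hball a) (div_le_div₀ hV0 (hV a) hθ (hqθ a))
          (div_nonneg (abs_nonneg _) (hθ.le.trans (hqθ a))) (inv_pos.2 hκ).le
    _ = V / (κ * θ) := by field_simp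

/-- Importance weighting: the mean of the loss model at `x` is the average of the loss over the
ball around `x`, hence close to the loss at `x` if the loss is Lipschitz. -/
lemma abs_integral_lossModel_sub_le [IsFiniteMeasure (leb X)] {r κ θ L : ℝ} (hL : 0 ≤ L)
    (hκ : 0 < κ) {x : X} (hball : ∀ x : X, κ ≤ (leb X).real (Metric.closedBall x r))
    {q l : X → ℝ} (hl : BddMeas l) (hθ : 0 < θ) (hqθ : ∀ x, θ ≤ q x)
    (hlip : ∀ x x', |l x' - l x| ≤ L * dist x' x) :
    |(∫ a, lossModel r q l a x * q a ∂(leb X)) - l x| ≤ L * r := by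
  have hK : BddMeas fun a : X => ballKernel r x a := (bddMeas_ballKernel hκ hball).slice x
  have h1 : ∀ a, lossModel r q l a x * q a = ballKernel r x a * l a := fun a => by
    have : q a ≠ 0 := (hθ.trans_le (hqθ a)).ne'
    unfold lossModel
    field_simp
  have h2 : (∫ a, lossModel r q l a x * q a ∂(leb X)) - l x
      = ∫ a, ballKernel r x a * (l a - l x) ∂(leb X) := by
    simp_rw [h1, mul_sub]
    rw [integral_sub ((hK.mul hl).integrable _) ((hK.mul (BddMeas.const _)).integrable _),
      integral_mul_const, integral_ballKernel (hκ.trans_le (hball x)), one_mul]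
  have h3 : ∀ a, |ballKernel r x a * (l a - l x)| ≤ ballKernel r x a * (L * r) := fun a => by
    rw [abs_mul, abs_of_nonneg (ballKernel_nonneg _ _ _)]
    rcases le_or_gt (dist a x) r with h | h
    · exact mul_le_mul_of_nonneg_left ((hlip x a).trans (mul_le_mul_of_nonneg_left h hL))
        (ballKernel_nonneg _ _ _)
    · simp [ballKernel_of_lt_dist h]
  rw [h2]
  calc |∫ a, ballKernel r x a * (l a - l x) ∂(leb X)|
      ≤ ∫ a, |ballKernel r x a * (l a - l x)| ∂(leb X) := abs_integral_le_integral_abs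
    _ ≤ ∫ a, ballKernel r x a * (L * r) ∂(leb X) :=
        integral_mono ((hK.mul (hl.sub (BddMeas.const _))).integrable _).abs
          ((hK.mul (BddMeas.const _)).integrable _) h3
    _ = L * r := by
        rw [integral_mul_const, integral_ballKernel (hκ.trans_le (hball x)), one_mul]

/-- The second moment of the loss model at `x` is of the order of one over the measure of the ball
times the smallest sampling density: one of the two importance weights is averaged out. -/
lemma integral_lossModel_sq_le [IsFiniteMeasure (leb X)] {r κ θ V : ℝ}
    (hκ : 0 < κ) {x : X} (hball : ∀ x : X, κ ≤ (leb X).real (Metric.closedBall x r))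
    {q l : X → ℝ} (hl : BddMeas l) (hq : BddMeas q) (hθ : 0 < θ) (hqθ : ∀ x, θ ≤ q x)
    (hV : ∀ x, |l x| ≤ V) :
    ∫ a, lossModel r q l a x ^ 2 * q a ∂(leb X) ≤ V ^ 2 / (κ * θ) := by
  have hK : BddMeas fun a : X => ballKernel r x a := (bddMeas_ballKernel hκ hball).slice x
  have hint : BddMeas fun a => lossModel r q l a x ^ 2 * q a :=
    (hK.mul (hl.div hq hθ hqθ)).sq.mul hq
  calc ∫ a, lossModel r q l a x ^ 2 * q a ∂(leb X)
      ≤ ∫ a, ballKernel r x a * (V ^ 2 / (κ * θ)) ∂(leb X) := by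
        refine integral_mono (hint.integrable _) ((hK.mul (BddMeas.const _)).integrable _)
          fun a => ?_
        have hqa : 0 < q a := hθ.trans_le (hqθ a)
        have e : lossModel r q l a x ^ 2 * q a
            = ballKernel r x a * (ballKernel r x a * (l a ^ 2 / q a)) := by
          unfold lossModel
          field_simp
        have e2 : V ^ 2 / (κ * θ) = κ⁻¹ * (V ^ 2 / θ) := by field_simp
        simp only [e, e2]
        refine mul_le_mul_of_nonneg_left ?_ (ballKernel_nonneg _ _ _)
        refine mul_le_mul (ballKernel_le hκ (hball x) a) ?_ (by positivity) (inv_pos.2 hκ).le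
        refine div_le_div₀ (sq_nonneg V) ?_ hθ (hqθ a)
        exact sq_le_sq' (neg_le_of_abs_le (hV a)) ((le_abs_self _).trans (hV a))
    _ = V ^ 2 / (κ * θ) := by
        rw [integral_mul_const, integral_ballKernel (hκ.trans_le (hball x)), one_mul]

end Estimator

/-! ### Means under a density -/

section Density

variable {α : Type*} [MeasurableSpace α] {μ : Measure α}

/-- The density of the uniform distribution on `S`. -/
noncomputable def uniformDensity (μ : Measure α) (S : Set α) : α → ℝ :=
  S.indicator fun _ => (μ.real S)⁻¹

lemma bddMeas_uniformDensity {S : Set α} (hS : MeasurableSet S) :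
    BddMeas (uniformDensity μ S) := by
  refine ⟨measurable_const.indicator hS, (μ.real S)⁻¹, fun x => ?_⟩
  unfold uniformDensity
  by_cases hx : x ∈ S <;> simp [hx, abs_of_nonneg]

lemma uniformDensity_nonneg (S : Set α) (x : α) : 0 ≤ uniformDensity μ S x :=
  Set.indicator_nonneg (fun _ _ => inv_nonneg.2 measureReal_nonneg) _

lemma setAverage_eq_integral_mul {S : Set α} (hS : MeasurableSet S) (f : α → ℝ) :
    (⨍ x in S, f x ∂μ) = ∫ x, f x * uniformDensity μ S x ∂μ := by
  have h : (fun x => f x * uniformDensity μ S x)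
      = S.indicator fun x => f x * (μ.real S)⁻¹ := by
    funext x
    by_cases hx : x ∈ S <;> simp [uniformDensity, hx]
  rw [h, integral_indicator hS, setAverage_eq, integral_mul_const, smul_eq_mul, mul_comm]

lemma integral_uniformDensity {S : Set α} (hS : MeasurableSet S) (h : 0 < μ.real S) :
    ∫ x, uniformDensity μ S x ∂μ = 1 := by
  unfold uniformDensity
  rw [integral_indicator hS, setIntegral_const, smul_eq_mul, mul_inv_cancel₀ h.ne']

variable [IsFiniteMeasure μ]

lemma integral_mul_le_of_le {f g w : α → ℝ} (hf : BddMeas f) (hg : BddMeas g) (hw : BddMeas w)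
    (hw0 : ∀ x, 0 ≤ w x) (hfg : ∀ x, f x ≤ g x) :
    ∫ x, f x * w x ∂μ ≤ ∫ x, g x * w x ∂μ :=
  integral_mono ((hf.mul hw).integrable _) ((hg.mul hw).integrable _)
    fun x => mul_le_mul_of_nonneg_right (hfg x) (hw0 x)

lemma integral_mul_le_const {f w : α → ℝ} (hf : BddMeas f) (hw : BddMeas w)
    (hw0 : ∀ x, 0 ≤ w x) (hw1 : ∫ x, w x ∂μ = 1) {c : ℝ} (hfc : ∀ x, f x ≤ c) :
    ∫ x, f x * w x ∂μ ≤ c := by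
  have h := integral_mul_le_of_le (μ := μ) hf (BddMeas.const c) hw hw0 hfc
  rwa [integral_const_mul, hw1, mul_one] at h

lemma const_le_integral_mul {f w : α → ℝ} (hf : BddMeas f) (hw : BddMeas w)
    (hw0 : ∀ x, 0 ≤ w x) (hw1 : ∫ x, w x ∂μ = 1) {c : ℝ} (hfc : ∀ x, c ≤ f x) :
    c ≤ ∫ x, f x * w x ∂μ := by
  have h := integral_mul_le_of_le (μ := μ) (BddMeas.const c) hf hw hw0 hfc
  rwa [integral_const_mul, hw1, mul_one] at h

lemma integral_integral_mul_swap {F : α × α → ℝ} (hF : BddMeas F) {w q : α → ℝ}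
    (hw : BddMeas w) (hq : BddMeas q) :
    ∫ a, (∫ x, F (a, x) * w x ∂μ) * q a ∂μ = ∫ x, (∫ a, F (a, x) * q a ∂μ) * w x ∂μ := by
  have hG : BddMeas fun p : α × α => F p * w p.2 * q p.1 :=
    (hF.mul hw.snd).mul hq.fst
  simp_rw [← integral_mul_const]
  rw [integral_integral_swap (f := fun a x => F (a, x) * w x * q a) (hG.integrable _)]
  refine integral_congr_ae (Filter.Eventually.of_forall fun x => ?_)
  refine integral_congr_ae (Filter.Eventually.of_forall fun a => ?_)
  simp only
  ring

end Density

/-! ### One round of bandit dual averaging -/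

/-- One round, conditionally on the past, which fixes the sampling density `q` and the Gibbs density
`Λ` of Hedge. The mean over the sampled action of the regret of Hedge on the loss model, against the
uniform distribution on a ball of radius `ρ` around `x₀` and corrected by the second-order term,
controls the true regret of `Λ` against `x₀`. -/
lemma regret_le_integral_lossModel {d : ℕ} {X : Set (Euc d)} [IsFiniteMeasure (leb X)]
    {r κ θ V L C ρ : ℝ} (hL : 0 ≤ L) (hκ : 0 < κ)
    (hball : ∀ x : X, κ ≤ (leb X).real (Metric.closedBall x r)) {l q Λ : X → ℝ}
    (hl : BddMeas l) (hV : ∀ x, |l x| ≤ V) (hlip : ∀ x x', |l x' - l x| ≤ L * dist x' x)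
    (hq : BddMeas q) (hθ : 0 < θ) (hqθ : ∀ x, θ ≤ q x) (hΛ : BddMeas Λ) (hΛ0 : ∀ x, 0 ≤ Λ x)
    (hΛ1 : ∫ x, Λ x ∂(leb X) = 1) (hC : 0 ≤ C) {x₀ : X}
    (hρ : 0 < (leb X).real (Metric.closedBall x₀ ρ)) :
    (∫ x, l x * Λ x ∂(leb X)) - l x₀ - (2 * (L * r) + L * ρ + C * (V ^ 2 / (κ * θ)))
      ≤ ∫ a, ((∫ x, lossModel r q l a x * Λ x ∂(leb X))
          - (⨍ x in Metric.closedBall x₀ ρ, lossModel r q l a x ∂(leb X))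
          - C * ∫ x, lossModel r q l a x ^ 2 * Λ x ∂(leb X)) * q a ∂(leb X) := by
  have hSm : MeasurableSet (Metric.closedBall x₀ ρ) := Metric.isClosed_closedBall.measurableSet
  set u := uniformDensity (leb X) (Metric.closedBall x₀ ρ) with hudef
  have hu : BddMeas u := bddMeas_uniformDensity hSm
  have hu1 : ∫ x, u x ∂(leb X) = 1 := integral_uniformDensity hSm hρ
  have hu0 : ∀ x, 0 ≤ u x := uniformDensity_nonneg _
  have hF : BddMeas fun p : X × X => lossModel r q l p.1 p.2 :=
    bddMeas_lossModel hκ hball hl (q := fun _ => q) hq.snd hθ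
      (fun _ => hqθ) (φ := fun a => a) measurable_id
  have hmean : BddMeas fun x => ∫ a, lossModel r q l a x * q a ∂(leb X) :=
    BddMeas.integral_right (F := fun p : X × X => lossModel r q l p.2 p.1 * q p.2)
      (hF.swap.mul hq.snd) (leb X)
  have hmean2 : BddMeas fun x => ∫ a, lossModel r q l a x ^ 2 * q a ∂(leb X) :=
    BddMeas.integral_right (F := fun p : X × X => lossModel r q l p.2 p.1 ^ 2 * q p.2)
      (hF.sq.swap.mul hq.snd) (leb X)
  have hbias := fun x => abs_le.1 (abs_integral_lossModel_sub_le (x := x) hL hκ hball hl hθ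
    hqθ hlip)
  simp_rw [setAverage_eq_integral_mul hSm, ← hudef]
  have hA : ∀ w : X → ℝ, BddMeas w →
      BddMeas fun a => (∫ x, lossModel r q l a x * w x ∂(leb X)) * q a := fun w hw =>
    (BddMeas.integral_right (F := fun p : X × X => lossModel r q l p.1 p.2 * w p.2)
      (hF.mul hw.snd) (leb X)).mul hq
  have hA2 : BddMeas fun a => (∫ x, lossModel r q l a x ^ 2 * Λ x ∂(leb X)) * q a :=
    (BddMeas.integral_right (F := fun p : X × X => lossModel r q l p.1 p.2 ^ 2 * Λ p.2)
      (hF.sq.mul hΛ.snd) (leb X)).mul hq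
  simp_rw [sub_mul, mul_assoc C]
  rw [integral_sub (((hA _ hΛ).sub (hA _ hu)).integrable _) ((hA2.const_mul C).integrable _),
    integral_sub ((hA _ hΛ).integrable _) ((hA _ hu).integrable _), integral_const_mul,
    integral_integral_mul_swap hF hΛ hq, integral_integral_mul_swap hF hu hq,
    integral_integral_mul_swap hF.sq hΛ hq]
  have h1 : (∫ x, l x * Λ x ∂(leb X)) - L * r
      ≤ ∫ x, (∫ a, lossModel r q l a x * q a ∂(leb X)) * Λ x ∂(leb X) := by
    have h := integral_mul_le_of_le (μ := leb X) (hl.sub (BddMeas.const (L * r))) hmean hΛ hΛ0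
      fun x => by linarith [(hbias x).1]
    simp_rw [sub_mul] at h
    rwa [integral_sub ((hl.mul hΛ).integrable _) ((hΛ.const_mul _).integrable _),
      integral_const_mul, hΛ1, mul_one] at h
  have h2 : ∫ x, (∫ a, lossModel r q l a x * q a ∂(leb X)) * u x ∂(leb X)
      ≤ l x₀ + L * ρ + L * r := by
    have h : ∀ x, (∫ a, lossModel r q l a x * q a ∂(leb X)) * u x
        ≤ (l x₀ + L * ρ + L * r) * u x := fun x => by
      by_cases hx : x ∈ Metric.closedBall x₀ ρ
      · refine mul_le_mul_of_nonneg_right ?_ (hu0 x)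
        have h3 := (abs_le.1 (hlip x₀ x)).2
        have h4 : L * dist x x₀ ≤ L * ρ := mul_le_mul_of_nonneg_left hx hL
        linarith [(hbias x).2]
      · have : u x = 0 := Set.indicator_of_notMem hx _
        simp [this]
    have h3 := integral_mono ((hmean.mul hu).integrable (leb X)) ((hu.const_mul _).integrable _) h
    rwa [integral_const_mul, hu1, mul_one] at h3
  have h3 : ∫ x, (∫ a, lossModel r q l a x ^ 2 * q a ∂(leb X)) * Λ x ∂(leb X)
      ≤ V ^ 2 / (κ * θ) :=
    integral_mul_le_const hmean2 hΛ hΛ0 hΛ1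
      fun x => integral_lossModel_sq_le hκ hball hl hq hθ hqθ hV
  have h5 := mul_le_mul_of_nonneg_left h3 hC
  linarith

/-! ### The mixed strategy -/

section Strategy

variable {d : ℕ} {X : Set (Euc d)}

lemma logit_nonneg (y : X → ℝ) (x : X) : 0 ≤ logit y x :=
  div_nonneg (Real.exp_pos _).le (integral_nonneg fun _ => (Real.exp_pos _).le)

lemma le_mixedStrategy {e : ℝ} (he : e ≤ 1) (c : ℝ) (y : X → ℝ) (x : X) :
    e / (leb X).real Set.univ ≤ mixedStrategy c e y x :=
  le_add_of_nonneg_left (mul_nonneg (sub_nonneg.2 he) (logit_nonneg _ _))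

variable [IsFiniteMeasure (leb X)] [NeZero (leb X)]

variable (X) in
lemma leb_real_univ_pos : 0 < (leb X).real Set.univ := by simp

/-- The logit map is measurable and bounded jointly in the action and a parameter of the scores. -/
lemma bddMeas_logit {β : Type*} [MeasurableSpace β] {y : β → X → ℝ}
    (hy : BddMeas fun p : β × X => y p.1 p.2) : BddMeas fun p : β × X => logit (y p.1) p.2 := by
  obtain ⟨C, hC⟩ := hy.bdd
  have hden : BddMeas fun p : β × X => ∫ z, Real.exp (y p.1 z) ∂(leb X) :=
    (hy.exp.integral_right (leb X)).comp measurable_fst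
  refine hy.exp.div hden (mul_pos (Real.exp_pos (-C)) (leb_real_univ_pos X)) fun p => ?_
  have hyp : BddMeas fun z => y p.1 z := hy.slice p.1
  exact hyp.integral_exp_ge (fun z => hC (p.1, z)) (leb X)

lemma bddMeas_logit_apply {y : X → ℝ} (hy : BddMeas y) : BddMeas (logit y) :=
  (bddMeas_logit (β := Unit) (y := fun _ => y) hy.snd).slice ()

lemma integral_logit {y : X → ℝ} (hy : BddMeas y) : ∫ x, logit y x ∂(leb X) = 1 := by
  unfold logit
  rw [integral_div, div_self (hy.integral_exp_pos (leb X)).ne']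

lemma bddMeas_mixedStrategy {β : Type*} [MeasurableSpace β] {y : β → X → ℝ}
    (hy : BddMeas fun p : β × X => y p.1 p.2) (c e : ℝ) :
    BddMeas fun p : β × X => mixedStrategy c e (y p.1) p.2 :=
  ((bddMeas_logit (y := fun b z => c * y b z) (hy.const_mul c)).const_mul (1 - e)).add
    (BddMeas.const (e / (leb X).real Set.univ))

lemma integral_mul_mixedStrategy {l y : X → ℝ} (hl : BddMeas l) (hy : BddMeas y) (c e : ℝ) :
    ∫ x, l x * mixedStrategy c e y x ∂(leb X)
      = (1 - e) * (∫ x, l x * logit (fun z => c * y z) x ∂(leb X))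
        + e * ((∫ x, l x ∂(leb X)) / (leb X).real Set.univ) := by
  have hΛ := bddMeas_logit_apply (hy.const_mul c)
  have h : ∀ x, l x * mixedStrategy c e y x = (1 - e) * (l x * logit (fun z => c * y z) x)
      + e / (leb X).real Set.univ * l x := fun x => by unfold mixedStrategy; ring
  simp_rw [h]
  rw [integral_add (((hl.mul hΛ).const_mul _).integrable _) ((hl.const_mul _).integrable _),
    integral_const_mul, integral_const_mul]
  ring

lemma integral_mixedStrategy {y : X → ℝ} (hy : BddMeas y) (c e : ℝ) :
    ∫ x, mixedStrategy c e y x ∂(leb X) = 1 := by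
  have h := integral_mul_mixedStrategy (BddMeas.const 1) hy c e
  simp only [one_mul] at h
  rw [h, integral_logit (hy.const_mul c), integral_const, smul_eq_mul, mul_one, mul_one,
    div_self (leb_real_univ_pos X).ne']
  ring

/-- Explicit exploration costs at most `2 * V * e`. -/
lemma integral_mul_mixedStrategy_le {l y : X → ℝ} (hl : BddMeas l) (hy : BddMeas y) {c e V : ℝ}
    (he : 0 ≤ e) (hV : ∀ x, |l x| ≤ V) :
    ∫ x, l x * mixedStrategy c e y x ∂(leb X)
      ≤ (∫ x, l x * logit (fun z => c * y z) x ∂(leb X)) + 2 * V * e := by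
  have hm : 0 < (leb X).real Set.univ := leb_real_univ_pos X
  have h1 := const_le_integral_mul (μ := leb X) hl (bddMeas_logit_apply (hy.const_mul c))
    (logit_nonneg _) (integral_logit (hy.const_mul c)) fun x => neg_le_of_abs_le (hV x)
  have h2 : (∫ x, l x ∂(leb X)) / (leb X).real Set.univ ≤ V := by
    rw [div_le_iff₀ hm]
    calc ∫ x, l x ∂(leb X) ≤ ∫ _, V ∂(leb X) :=
          integral_mono (hl.integrable _) ((BddMeas.const V).integrable _)
            fun x => (le_abs_self _).trans (hV x)
      _ = _ := by rw [integral_const, smul_eq_mul, mul_comm]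
  rw [integral_mul_mixedStrategy hl hy]
  nlinarith

end Strategy

/-! ### Scores and policies as functions of the past -/

section Score

variable {d : ℕ} {X : Set (Euc d)} {ℓ : ℕ → X → ℝ} {η δ ε : ℕ → ℝ}

lemma score_congr {a a' : ℕ → X} {t : ℕ} (h : ∀ s < t, a s = a' s) :
    score ℓ η δ ε a t = score ℓ η δ ε a' t := by
  induction t with
  | zero => rfl
  | succ t ih =>
    funext x
    simp only [score, ih fun s hs => h s (hs.trans t.lt_succ_self), h t t.lt_succ_self]

lemma policy_congr {a a' : ℕ → X} {t : ℕ} (h : ∀ s < t, a s = a' s) :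
    policy ℓ η δ ε a t = policy ℓ η δ ε a' t := by
  unfold policy
  rw [score_congr h]

lemma le_policy (hε1 : ∀ t, ε t ≤ 1) (a : ℕ → X) (t : ℕ) (x : X) :
    ε t / (leb X).real Set.univ ≤ policy ℓ η δ ε a t x :=
  le_mixedStrategy (hε1 t) _ _ _

variable [IsFiniteMeasure (leb X)] [NeZero (leb X)]

/-- The scores are bounded and measurable jointly in the sequence of actions and the evaluation
point. -/
lemma bddMeas_score (hball : ∀ t, ∃ κ > 0, ∀ x : X, κ ≤ (leb X).real (Metric.closedBall x (δ t)))
    (hε0 : ∀ t, 0 < ε t) (hε1 : ∀ t, ε t ≤ 1) (hℓ : ∀ t, BddMeas (ℓ t)) (t : ℕ) :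
    BddMeas fun p : (ℕ → X) × X => score ℓ η δ ε p.1 t p.2 := by
  induction t with
  | zero => exact BddMeas.const 0
  | succ t ih =>
    obtain ⟨κ, hκ, hκb⟩ := hball t
    exact ih.sub (bddMeas_lossModel (q := fun a => policy ℓ η δ ε a t) (φ := fun a => a t) hκ hκb
      (hℓ t) (bddMeas_mixedStrategy (y := fun a => score ℓ η δ ε a t) ih (η t) (ε t))
      (div_pos (hε0 t) (leb_real_univ_pos X))
      (fun a => le_policy hε1 a t) (measurable_pi_apply t))

lemma bddMeas_policy (hball : ∀ t, ∃ κ > 0, ∀ x : X, κ ≤ (leb X).real (Metric.closedBall x (δ t)))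
    (hε0 : ∀ t, 0 < ε t) (hε1 : ∀ t, ε t ≤ 1) (hℓ : ∀ t, BddMeas (ℓ t)) (t : ℕ) :
    BddMeas fun p : (ℕ → X) × X => policy ℓ η δ ε p.1 t p.2 :=
  bddMeas_mixedStrategy (y := fun a => score ℓ η δ ε a t)
    (bddMeas_score hball hε0 hε1 hℓ t) (η t) (ε t)

end Score

/-! ### The conditional law of the actions -/

section CondLaw

variable {d : ℕ} {X : Set (Euc d)} {Ω : Type*}

/-- The actions before round `t`, continued by the constant action `x₀`. -/
def past (a : ℕ → Ω → X) (x₀ : X) (t : ℕ) (ω : Ω) (s : ℕ) : X :=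
  if s < t then a s ω else x₀

lemma past_of_lt {a : ℕ → Ω → X} {x₀ : X} {s t : ℕ} (h : s < t) (ω : Ω) :
    past a x₀ t ω s = a s ω := if_pos h

lemma measurable_past_comap (a : ℕ → Ω → X) (x₀ : X) (t : ℕ) :
    Measurable[MeasurableSpace.comap (fun ω (s : Fin t) => a s ω) inferInstance]
      (past a x₀ t) := by
  have h : past a x₀ t = (fun (f : Fin t → X) (s : ℕ) => if hs : s < t then f ⟨s, hs⟩ else x₀) ∘
      fun ω (s : Fin t) => a s ω := by
    funext ω s
    by_cases hs : s < t <;> simp [past, hs]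
  rw [h]
  refine Measurable.comp (measurable_pi_lambda _ fun s => ?_) (comap_measurable _)
  by_cases hs : s < t
  · simpa [hs] using measurable_pi_apply _
  · simp [hs]

lemma measurable_past [MeasurableSpace Ω] {a : ℕ → Ω → X} (ha : ∀ t, Measurable (a t)) (x₀ : X)
    (t : ℕ) : Measurable (past a x₀ t) := measurable_pi_lambda _ fun s => by
  by_cases hs : s < t
  · simpa [past, hs] using ha s
  · simp [past, hs]

variable [IsFiniteMeasure (leb X)] {ℓ : ℕ → X → ℝ} {η δ ε : ℕ → ℝ} [MeasurableSpace Ω]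
  {P : Measure Ω} {a : ℕ → Ω → X}

/-- The joint law of the past and the action of round `t` has density `policy … t` with respect to
the product of the law of the past and Lebesgue measure. -/
lemma IsPlay.map_past_prodMk [IsProbabilityMeasure P] (h : IsPlay P ℓ η δ ε a) {x₀ : X} {t : ℕ}
    (hpol : BddMeas fun p : (ℕ → X) × X => policy ℓ η δ ε p.1 t p.2)
    (hpol0 : ∀ a x, 0 ≤ policy ℓ η δ ε a t x) :
    P.map (fun ω => (past a x₀ t ω, a t ω)) =
      ((P.map (past a x₀ t)).prod (leb X)).withDensity
        fun p => ENNReal.ofReal (policy ℓ η δ ε p.1 t p.2) := by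
  have hmle := (measurable_pi_lambda (fun ω (s : Fin t) => a s ω)
    fun s : Fin t => h.measurable s).comap_le
  have hH := measurable_past_comap a x₀ t
  have hH' : Measurable (past a x₀ t) := measurable_past h.measurable x₀ t
  have hpair : Measurable fun ω => (past a x₀ t ω, a t ω) := hH'.prodMk (h.measurable t)
  have : IsProbabilityMeasure (P.map (past a x₀ t)) :=
    Measure.isProbabilityMeasure_map hH'.aemeasurable
  have : IsFiniteMeasure (P.map fun ω => (past a x₀ t ω, a t ω)) := inferInstance
  refine Measure.ext_prod fun {A B} hA hB => ?_
  rw [Measure.map_apply hpair (hA.prod hB), withDensity_apply _ (hA.prod hB),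
    ← ofReal_integral_eq_lintegral_ofReal (hpol.integrable _).integrableOn
      (Filter.Eventually.of_forall fun p => hpol0 _ _),
    setIntegral_prod _ (hpol.integrable _).integrableOn,
    setIntegral_map hA (hpol.measurable.stronglyMeasurable.integral_prod_right'
      (ν := (leb X).restrict B)).aestronglyMeasurable hH'.aemeasurable]
  have hpre : (fun ω => (past a x₀ t ω, a t ω)) ⁻¹' A ×ˢ B
      = a t ⁻¹' B ∩ past a x₀ t ⁻¹' A := by
    ext ω; simp [and_comm]
  have hBm : MeasurableSet (a t ⁻¹' B) := h.measurable t hB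
  rw [hpre, ← ofReal_measureReal]
  congr 1
  have hi : Integrable ((a t ⁻¹' B).indicator fun _ => (1 : ℝ)) P :=
    (integrable_const 1).indicator hBm
  have hc := setIntegral_condExp hmle hi (hH hA)
  rw [setIntegral_congr_ae (g := fun ω => ∫ x in B, policy ℓ η δ ε (past a x₀ t ω) t x ∂(leb X))
    (hmle _ (hH hA)) ?_, integral_indicator hBm, Measure.restrict_restrict hBm] at hc
  · rw [hc]
    simp
  · filter_upwards [h.condLaw t B hB] with ω hω _
    rw [hω, policy_congr fun s hs => (past_of_lt hs ω).symm]

/-- Integrating out the action of round `t`, given the past. -/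
lemma IsPlay.integral_past_eq [IsProbabilityMeasure P] (h : IsPlay P ℓ η δ ε a) {x₀ : X} {t : ℕ}
    (hpol : BddMeas fun p : (ℕ → X) × X => policy ℓ η δ ε p.1 t p.2)
    (hpol0 : ∀ a x, 0 ≤ policy ℓ η δ ε a t x) {G : (ℕ → X) × X → ℝ} (hG : BddMeas G) :
    ∫ ω, G (past a x₀ t ω, a t ω) ∂P =
      ∫ ω, ∫ x, G (past a x₀ t ω, x) * policy ℓ η δ ε (past a x₀ t ω) t x ∂(leb X) ∂P := by
  have hH : Measurable (past a x₀ t) := measurable_past h.measurable x₀ t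
  have : IsProbabilityMeasure (P.map (past a x₀ t)) :=
    Measure.isProbabilityMeasure_map hH.aemeasurable
  have hpair : Measurable fun ω => (past a x₀ t ω, a t ω) := hH.prodMk (h.measurable t)
  have hGp := hG.mul hpol
  rw [← integral_map (φ := fun ω => (past a x₀ t ω, a t ω)) hpair.aemeasurable
      hG.measurable.aestronglyMeasurable, h.map_past_prodMk hpol hpol0,
    integral_withDensity_eq_integral_toReal_smul hpol.measurable.ennreal_ofReal
      (Filter.Eventually.of_forall fun p => ENNReal.ofReal_lt_top)]
  simp_rw [ENNReal.toReal_ofReal (hpol0 _ _), smul_eq_mul, mul_comm (policy _ _ _ _ _ _ _)]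
  rw [integral_prod _ (hGp.integrable _), integral_map hH.aemeasurable
    (hGp.measurable.stronglyMeasurable.integral_prod_right' (ν := leb X)).aestronglyMeasurable]

end CondLaw

/-! ### Expected regret in terms of the parameter sequences -/

section ExpectedRegret

variable {d : ℕ} {X : Set (Euc d)}

/-- The gap between Hedge, with scores `y` and learning rate `c`, and the uniform distribution
on `S`, measured on the loss model built from the action `a` and corrected by `C` times the
second-order term. -/
noncomputable def modelGap (r c C : ℝ) (S : Set X) (q l y : X → ℝ) (a : X) : ℝ :=
  (∫ x, lossModel r q l a x * logit (fun z => c * y z) x ∂(leb X))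
    - (⨍ x in S, lossModel r q l a x ∂(leb X))
    - C * ∫ x, lossModel r q l a x ^ 2 * logit (fun z => c * y z) x ∂(leb X)

variable [IsFiniteMeasure (leb X)] [NeZero (leb X)]

lemma bddMeas_modelGap {β : Type*} [MeasurableSpace β] {r κ θ c C : ℝ} (S : Set X)
    (hκ : 0 < κ) (hball : ∀ x : X, κ ≤ (leb X).real (Metric.closedBall x r)) {l : X → ℝ}
    (hl : BddMeas l) {q y : β → X → ℝ} (hq : BddMeas fun p : β × X => q p.1 p.2) (hθ : 0 < θ)
    (hqθ : ∀ b x, θ ≤ q b x) (hy : BddMeas fun p : β × X => y p.1 p.2) :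
    BddMeas fun p : β × X => modelGap r c C S (q p.1) l (y p.1) p.2 := by
  have hF : BddMeas fun p : (β × X) × X => lossModel r (q p.1.1) l p.1.2 p.2 :=
    bddMeas_lossModel (β := β × X) (q := fun p => q p.1) (φ := fun p => p.2) hκ hball hl
      (hq.comp (φ := fun p : (β × X) × X => (p.1.1, p.2)) (by fun_prop)) hθ
      (fun b => hqθ b.1) measurable_snd
  have hΛ : BddMeas fun p : (β × X) × X => logit (fun z => c * y p.1.1 z) p.2 :=
    (bddMeas_logit (y := fun b z => c * y b z) (hy.const_mul c)).comp
      (φ := fun p : (β × X) × X => (p.1.1, p.2)) (by fun_prop)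
  unfold modelGap
  simp_rw [setAverage_eq, smul_eq_mul]
  exact (((hF.mul hΛ).integral_right (leb X)).sub
    ((hF.integral_right ((leb X).restrict S)).const_mul _)).sub
    (((hF.sq.mul hΛ).integral_right (leb X)).const_mul C)

variable {ℓ : ℕ → X → ℝ} {η δ ε κ : ℕ → ℝ} {V L M : ℝ}

/-- Along every sequence of actions, the accumulated gaps are bounded by the relative entropy of
the comparator, divided by the last learning rate. -/
lemma sum_modelGap_le (hκ : ∀ t, 0 < κ t)
    (hball : ∀ t (x : X), κ t ≤ (leb X).real (Metric.closedBall x (δ t)))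
    (hε0 : ∀ t, 0 < ε t) (hε1 : ∀ t, ε t ≤ 1) (hη : ∀ t, 0 < η t) (hanti : Antitone η)
    (hℓ : ∀ t, BddMeas (ℓ t)) (hV : ∀ t x, |ℓ t x| ≤ V)
    (hM : ∀ t, η t * (V / (κ t * (ε t / (leb X).real Set.univ))) ≤ M)
    {S : Set X} (hS : 0 < (leb X).real S) (a : ℕ → X) (T : ℕ) :
    ∑ t ∈ Finset.range (T + 1), modelGap (δ t) (η t) (Real.exp M * η t) S
        (policy ℓ η δ ε a t) (ℓ t) (score ℓ η δ ε a t) (a t)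
      ≤ Real.log ((leb X).real Set.univ / (leb X).real S) / η T := by
  have hθ : ∀ t, 0 < ε t / (leb X).real Set.univ := fun t =>
    div_pos (hε0 t) (leb_real_univ_pos X)
  have hpol : ∀ t, BddMeas (policy ℓ η δ ε a t) := fun t =>
    (bddMeas_policy (fun t => ⟨κ t, hκ t, hball t⟩) hε0 hε1 hℓ t).slice a
  refine hedge_regret_le (leb X) (y := fun t => score ℓ η δ ε a t)
    (z := fun t => lossModel (δ t) (policy ℓ η δ ε a t) (ℓ t) (a t))
    (fun _ => rfl) (fun _ _ => rfl) (fun t => ?_) hη hanti (M := M) (fun t x => ?_) hS T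
  · exact (bddMeas_lossModel (β := X) (q := fun _ => policy ℓ η δ ε a t) (φ := fun x => x)
      (hκ t) (hball t) (hℓ t) (hpol t).snd (hθ t) (fun _ => le_policy hε1 a t)
      measurable_id).slice (a t)
  · rw [abs_mul, abs_of_pos (hη t)]
    exact (mul_le_mul_of_nonneg_left (abs_lossModel_le (hκ t) (hball t x) (hθ t)
      (le_policy hε1 a t) (hV t) (a t)) (hη t).le).trans (hM t)

/-- In every round, the mean gap controls the mean regret of the round. -/
lemma IsPlay.integral_regret_round_le {Ω : Type*} [MeasurableSpace Ω] {P : Measure Ω}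
    [IsProbabilityMeasure P] {a : ℕ → Ω → X} (h : IsPlay P ℓ η δ ε a) (hκ : ∀ t, 0 < κ t)
    (hball : ∀ t (x : X), κ t ≤ (leb X).real (Metric.closedBall x (δ t)))
    (hε0 : ∀ t, 0 < ε t) (hε1 : ∀ t, ε t ≤ 1)
    (hℓ : ∀ t, BddMeas (ℓ t)) (hV : ∀ t x, |ℓ t x| ≤ V) (hL : 0 ≤ L)
    (hlip : ∀ t x x', |ℓ t x' - ℓ t x| ≤ L * dist x' x)
    {C ρ : ℝ} (hC : 0 ≤ C) {x₀ : X} (hρ : 0 < (leb X).real (Metric.closedBall x₀ ρ)) (t : ℕ) :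
    ∫ ω, ((∫ z, ℓ t z * policy ℓ η δ ε (fun s => a s ω) t z ∂(leb X)) - ℓ t x₀) ∂P
      ≤ (∫ ω, modelGap (δ t) (η t) C (Metric.closedBall x₀ ρ)
          (policy ℓ η δ ε (fun s => a s ω) t) (ℓ t) (score ℓ η δ ε (fun s => a s ω) t) (a t ω) ∂P)
        + (2 * V * ε t + 2 * (L * δ t) + L * ρ
          + C * (V ^ 2 / (κ t * (ε t / (leb X).real Set.univ)))) := by
  have hθ : 0 < ε t / (leb X).real Set.univ := div_pos (hε0 t) (leb_real_univ_pos X)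
  have hscore : BddMeas fun p : (ℕ → X) × X => score ℓ η δ ε p.1 t p.2 :=
    bddMeas_score (fun t => ⟨κ t, hκ t, hball t⟩) hε0 hε1 hℓ t
  have hpol : BddMeas fun p : (ℕ → X) × X => policy ℓ η δ ε p.1 t p.2 :=
    bddMeas_policy (fun t => ⟨κ t, hκ t, hball t⟩) hε0 hε1 hℓ t
  have hpol0 : ∀ a x, 0 ≤ policy ℓ η δ ε a t x := fun a x => hθ.le.trans (le_policy hε1 a t x)
  have hG : BddMeas fun p : (ℕ → X) × X => modelGap (δ t) (η t) C (Metric.closedBall x₀ ρ)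
      (policy ℓ η δ ε p.1 t) (ℓ t) (score ℓ η δ ε p.1 t) p.2 :=
    bddMeas_modelGap (q := fun a => policy ℓ η δ ε a t) (y := fun a => score ℓ η δ ε a t) _
      (hκ t) (hball t) (hℓ t) hpol hθ (fun a => le_policy hε1 a t) hscore
  have hpast : ∀ ω, policy ℓ η δ ε (fun s => a s ω) t = policy ℓ η δ ε (past a x₀ t ω) t :=
    fun ω => policy_congr fun s hs => (past_of_lt hs ω).symm
  have hpast' : ∀ ω, score ℓ η δ ε (fun s => a s ω) t = score ℓ η δ ε (past a x₀ t ω) t :=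
    fun ω => score_congr fun s hs => (past_of_lt hs ω).symm
  have hH : Measurable (past a x₀ t) := measurable_past h.measurable x₀ t
  simp_rw [hpast, hpast']
  rw [h.integral_past_eq hpol hpol0 hG]
  set B := 2 * V * ε t + 2 * (L * δ t) + L * ρ
    + C * (V ^ 2 / (κ t * (ε t / (leb X).real Set.univ))) with hB
  have hI1 : BddMeas fun ω => (∫ z, ℓ t z * policy ℓ η δ ε (past a x₀ t ω) t z ∂(leb X))
      - ℓ t x₀ :=
    ((((hℓ t).snd.mul hpol).integral_right (leb X)).comp hH).sub (BddMeas.const _)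
  have hI2 : BddMeas fun ω => ∫ x, modelGap (δ t) (η t) C (Metric.closedBall x₀ ρ)
      (policy ℓ η δ ε (past a x₀ t ω) t) (ℓ t) (score ℓ η δ ε (past a x₀ t ω) t) x
      * policy ℓ η δ ε (past a x₀ t ω) t x ∂(leb X) :=
    ((hG.mul hpol).integral_right (leb X)).comp hH
  have hle : ∀ ω, (∫ z, ℓ t z * policy ℓ η δ ε (past a x₀ t ω) t z ∂(leb X)) - ℓ t x₀ ≤
      (∫ x, modelGap (δ t) (η t) C (Metric.closedBall x₀ ρ)
      (policy ℓ η δ ε (past a x₀ t ω) t) (ℓ t) (score ℓ η δ ε (past a x₀ t ω) t) x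
      * policy ℓ η δ ε (past a x₀ t ω) t x ∂(leb X)) + B := fun ω => by
    have hy := hscore.slice (past a x₀ t ω)
    have h1 := integral_mul_mixedStrategy_le (c := η t) (hℓ t) hy (hε0 t).le (hV t)
    have h2 := regret_le_integral_lossModel hL (hκ t) (hball t) (hℓ t) (hV t) (hlip t)
      (hpol.slice (past a x₀ t ω)) hθ (le_policy hε1 _ t)
      (bddMeas_logit_apply (hy.const_mul (η t))) (logit_nonneg _)
      (integral_logit (hy.const_mul (η t))) hC hρ
    have h3 := add_le_add h1 h2
    unfold policy at h3 ⊢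
    unfold modelGap
    linarith
  have hI := integral_mono (hI1.integrable P) ((hI2.add (BddMeas.const B)).integrable P) hle
  rwa [integral_add (hI2.integrable P) ((BddMeas.const B).integrable P), integral_const,
    probReal_univ, one_smul] at hI

/-- The expected regret of bandit dual averaging against `x₀`. The parameter `κ t` is a lower bound
on the measure of the balls of the kernel, and `ρ` is the radius of the ball around `x₀` whose
uniform distribution replaces `x₀`. -/
theorem IsPlay.integral_regretAgainst_le {Ω : Type*} [MeasurableSpace Ω] {P : Measure Ω}
    [IsProbabilityMeasure P] {a : ℕ → Ω → X} (h : IsPlay P ℓ η δ ε a) (hκ : ∀ t, 0 < κ t)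
    (hball : ∀ t (x : X), κ t ≤ (leb X).real (Metric.closedBall x (δ t)))
    (hε0 : ∀ t, 0 < ε t) (hε1 : ∀ t, ε t ≤ 1) (hη : ∀ t, 0 < η t) (hanti : Antitone η)
    (hℓ : ∀ t, BddMeas (ℓ t)) (hV : ∀ t x, |ℓ t x| ≤ V) (hL : 0 ≤ L)
    (hlip : ∀ t x x', |ℓ t x' - ℓ t x| ≤ L * dist x' x)
    (hM : ∀ t, η t * (V / (κ t * (ε t / (leb X).real Set.univ))) ≤ M)
    {ρ : ℝ} {x₀ : X} (hρ : 0 < (leb X).real (Metric.closedBall x₀ ρ)) (T : ℕ) :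
    ∫ ω, regretAgainst ℓ (policy ℓ η δ ε fun s => a s ω) (T + 1) x₀ ∂P
      ≤ Real.log ((leb X).real Set.univ / (leb X).real (Metric.closedBall x₀ ρ)) / η T
        + ∑ t ∈ Finset.range (T + 1), (2 * V * ε t + 2 * (L * δ t) + L * ρ
          + Real.exp M * η t * (V ^ 2 / (κ t * (ε t / (leb X).real Set.univ)))) := by
  have hθ : ∀ t, 0 < ε t / (leb X).real Set.univ := fun t =>
    div_pos (hε0 t) (leb_real_univ_pos X)
  have hpath : Measurable fun ω s => a s ω := measurable_pi_lambda _ h.measurable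
  have hpol : ∀ t, BddMeas fun p : (ℕ → X) × X => policy ℓ η δ ε p.1 t p.2 := fun t =>
    bddMeas_policy (fun t => ⟨κ t, hκ t, hball t⟩) hε0 hε1 hℓ t
  have hI1 : ∀ t, BddMeas fun ω =>
      (∫ z, ℓ t z * policy ℓ η δ ε (fun s => a s ω) t z ∂(leb X)) - ℓ t x₀ := fun t =>
    ((((hℓ t).snd.mul (hpol t)).integral_right (leb X)).comp hpath).sub (BddMeas.const _)
  have hI2 : ∀ t, BddMeas fun ω => modelGap (δ t) (η t) (Real.exp M * η t)
      (Metric.closedBall x₀ ρ) (policy ℓ η δ ε (fun s => a s ω) t) (ℓ t)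
      (score ℓ η δ ε (fun s => a s ω) t) (a t ω) := fun t =>
    (bddMeas_modelGap (q := fun a => policy ℓ η δ ε a t) (y := fun a => score ℓ η δ ε a t) _
      (hκ t) (hball t) (hℓ t) (hpol t) (hθ t) (fun a => le_policy hε1 a t)
      (bddMeas_score (fun t => ⟨κ t, hκ t, hball t⟩) hε0 hε1 hℓ t)).comp
      (φ := fun ω => ((fun s => a s ω), a t ω)) (hpath.prodMk (h.measurable t))
  have hsum := integral_mono ((BddMeas.sum _ fun t _ => hI2 t).integrable P)
    ((BddMeas.const _).integrable P)
    fun ω => sum_modelGap_le hκ hball hε0 hε1 hη hanti hℓ hV hM hρ (fun s => a s ω) T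
  rw [integral_finsetSum _ fun t _ => (hI2 t).integrable P, integral_const, probReal_univ,
    one_smul] at hsum
  unfold regretAgainst
  rw [integral_finsetSum _ fun t _ => (hI1 t).integrable P]
  refine (Finset.sum_le_sum fun t _ => h.integral_regret_round_le hκ hball hε0 hε1 hℓ hV hL
    hlip (mul_nonneg (Real.exp_pos M).le (hη t).le) hρ t).trans ?_
  rw [Finset.sum_add_distrib]
  exact add_le_add_left hsum _

end ExpectedRegret

/-! ### Polynomial parameter sequences -/

lemma polyDecay_pos {c : ℝ} (hc : 0 < c) (p : ℝ) (t : ℕ) : 0 < polyDecay c p t :=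
  mul_pos hc (Real.rpow_pos_of_pos (by positivity) _)

lemma polyDecay_antitone {c p : ℝ} (hc : 0 < c) (hp : 0 ≤ p) : Antitone (polyDecay c p) := by
  intro s t hst
  have hst' : (s : ℝ) + 1 ≤ t + 1 := by exact_mod_cast Nat.succ_le_succ hst
  exact mul_le_mul_of_nonneg_left
    (Real.rpow_le_rpow_of_nonpos (by positivity) hst' (neg_nonpos.2 hp)) hc.le

lemma polyDecay_le {c p : ℝ} (hc : 0 < c) (hp : 0 ≤ p) (t : ℕ) : polyDecay c p t ≤ c := by
  have h := polyDecay_antitone hc hp (Nat.zero_le t)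
  simpa [polyDecay] using h

/-- A partial sum of `∑ τ ^ (-s)` is bounded up to a constant by `T ^ (1 - s)` if `s < 1`, and by
`1 + log T` if `s ≥ 1`. -/
lemma exists_sum_rpow_neg_le (s : ℝ) : ∃ C : ℝ, 0 < C ∧ ∀ T : ℕ, 1 ≤ T →
    ∑ t ∈ Finset.range T, ((t : ℝ) + 1) ^ (-s) ≤ C * (1 + Real.log T + (T : ℝ) ^ (1 - s)) := by
  have hlog : ∀ T : ℕ, 1 ≤ T → 0 ≤ Real.log T := fun T hT =>
    Real.log_nonneg (by exact_mod_cast hT)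
  have hpow : ∀ T : ℕ, 0 ≤ (T : ℝ) ^ (1 - s) := fun T => Real.rpow_nonneg T.cast_nonneg _
  rcases le_or_gt 1 s with h1 | h1
  · refine ⟨1, one_pos, fun T hT => ?_⟩
    have h : ∑ t ∈ Finset.range T, ((t : ℝ) + 1) ^ (-s) ≤ (harmonic T : ℚ) := by
      rw [harmonic, Rat.cast_sum]
      refine Finset.sum_le_sum fun t _ => ?_
      push_cast
      rw [← Real.rpow_neg_one]
      exact Real.rpow_le_rpow_of_exponent_le (by simp) (by linarith)
    linarith [harmonic_le_one_add_log T, hpow T]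
  rcases le_or_gt 0 s with h0 | h0
  · have hr : 0 < 1 - s := by linarith
    refine ⟨(1 - s)⁻¹, inv_pos.2 hr, fun T hT => ?_⟩
    have h : ∀ n : ℕ, ∑ t ∈ Finset.range n, ((t : ℝ) + 1) ^ (-s)
        ≤ (1 - s)⁻¹ * (n : ℝ) ^ (1 - s) := by
      intro n
      induction n with
      | zero => simp [Real.zero_rpow hr.ne']
      | succ n ih =>
        rw [Finset.sum_range_succ]
        have hn : (0 : ℝ) < n + 1 := by positivity
        -- Bernoulli's inequality for `n = (n + 1) * (1 - 1 / (n + 1))`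
        have hB := rpow_one_add_le_one_add_mul_self (s := -((n : ℝ) + 1)⁻¹)
          (by rw [neg_le_neg_iff]; exact inv_le_one_of_one_le₀ (by simp)) hr.le
          (by linarith : 1 - s ≤ 1)
        have hn' : (n : ℝ) ^ (1 - s)
            = ((n : ℝ) + 1) ^ (1 - s) * (1 + -((n : ℝ) + 1)⁻¹) ^ (1 - s) := by
          rw [← Real.mul_rpow hn.le]
          · congr 1; field_simp; ring
          · have : ((n : ℝ) + 1)⁻¹ ≤ 1 := inv_le_one_of_one_le₀ (by simp)
            linarith
        have hsplit : ((n : ℝ) + 1) ^ (1 - s) = ((n : ℝ) + 1) * ((n : ℝ) + 1) ^ (-s) := by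
          rw [sub_eq_add_neg, Real.rpow_add hn, Real.rpow_one]
        have h2 : (n : ℝ) ^ (1 - s)
            ≤ ((n : ℝ) + 1) ^ (1 - s) - (1 - s) * ((n : ℝ) + 1) ^ (-s) := by
          rw [hn']
          refine (mul_le_mul_of_nonneg_left hB (Real.rpow_nonneg hn.le _)).trans (le_of_eq ?_)
          rw [hsplit]
          field_simp
          ring
        have h3 := mul_le_mul_of_nonneg_left h2 (inv_pos.2 hr).le
        rw [mul_sub, inv_mul_cancel_left₀ hr.ne'] at h3
        push_cast
        linarith
    have h2 : 0 ≤ (1 - s)⁻¹ * (1 + Real.log T) :=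
      mul_nonneg (inv_pos.2 hr).le (by linarith [hlog T hT])
    linarith [h T]
  · refine ⟨1, one_pos, fun T hT => ?_⟩
    have hT0 : (0 : ℝ) < T := by exact_mod_cast hT
    have h : ∑ t ∈ Finset.range T, ((t : ℝ) + 1) ^ (-s) ≤ T * (T : ℝ) ^ (-s) := by
      rw [← nsmul_eq_mul, ← Finset.card_range T]
      simp only [Finset.card_range]
      have := Finset.sum_le_card_nsmul (Finset.range T) (fun t => ((t : ℝ) + 1) ^ (-s))
        ((T : ℝ) ^ (-s)) fun t ht => Real.rpow_le_rpow (by positivity)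
          (by exact_mod_cast Finset.mem_range.1 ht) (by linarith)
      simpa using this
    have e : (T : ℝ) ^ (1 - s) = T * (T : ℝ) ^ (-s) := by
      rw [sub_eq_add_neg, Real.rpow_add hT0, Real.rpow_one]
    rw [e]
    linarith [hlog T hT]

/-! ### From the regret against a fixed action to the static regret -/

section Regret

variable {d : ℕ} {X : Set (Euc d)}

lemma bddMeas_of_lipschitz {l : X → ℝ} {V L : ℝ} (hL : 0 ≤ L) (hV : ∀ x, |l x| ≤ V)
    (hlip : ∀ x x', |l x' - l x| ≤ L * dist x' x) : BddMeas l := by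
  have h : LipschitzWith L.toNNReal l := LipschitzWith.of_dist_le_mul fun x y => by
    rw [Real.dist_eq, Real.coe_toNNReal _ hL]
    exact hlip y x
  exact ⟨h.continuous.measurable, V, hV⟩

variable [IsFiniteMeasure (leb X)] [NeZero (leb X)]
  {ℓ : ℕ → X → ℝ} {η δ ε : ℕ → ℝ} {V : ℝ}

/-- The regret never exceeds `2 * V` per round. -/
lemma IsPlay.integral_regretAgainst_le_trivial {Ω : Type*} [MeasurableSpace Ω] {P : Measure Ω}
    [IsProbabilityMeasure P] {a : ℕ → Ω → X} (h : IsPlay P ℓ η δ ε a)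
    (hball : ∀ t, ∃ κ > 0, ∀ x : X, κ ≤ (leb X).real (Metric.closedBall x (δ t)))
    (hε0 : ∀ t, 0 < ε t) (hε1 : ∀ t, ε t ≤ 1) (hℓ : ∀ t, BddMeas (ℓ t))
    (hV : ∀ t x, |ℓ t x| ≤ V) (T : ℕ) (x : X) :
    ∫ ω, regretAgainst ℓ (policy ℓ η δ ε fun s => a s ω) T x ∂P ≤ 2 * V * T := by
  have hpt : ∀ ω, regretAgainst ℓ (policy ℓ η δ ε fun s => a s ω) T x ≤ 2 * V * T := fun ω => by
    have hle : ∀ t ∈ Finset.range T, (∫ z, ℓ t z * policy ℓ η δ ε (fun s => a s ω) t z ∂(leb X))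
        - ℓ t x ≤ 2 * V := fun t _ => by
      have h1 := integral_mul_le_const (μ := leb X) (hℓ t)
        ((bddMeas_policy hball hε0 hε1 hℓ t).slice fun s => a s ω)
        (fun z => (div_pos (hε0 t) (leb_real_univ_pos X)).le.trans (le_policy hε1 _ t z))
        (integral_mixedStrategy ((bddMeas_score hball hε0 hε1 hℓ t).slice fun s => a s ω)
          (η t) (ε t)) fun z => (le_abs_self _).trans (hV t z)
      have h2 := (neg_le_abs _).trans (hV t x)
      linarith
    have hcard := Finset.sum_le_card_nsmul _ _ _ hle
    rwa [Finset.card_range, nsmul_eq_mul, mul_comm] at hcard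
  have hI : BddMeas fun ω => regretAgainst ℓ (policy ℓ η δ ε fun s => a s ω) T x :=
    BddMeas.sum _ fun t _ =>
      ((((hℓ t).snd.mul (bddMeas_policy hball hε0 hε1 hℓ t)).integral_right (leb X)).comp
        (φ := fun ω s => a s ω) (measurable_pi_lambda _ h.measurable)).sub (BddMeas.const _)
  have hmono := integral_mono (hI.integrable P) ((BddMeas.const _).integrable P) hpt
  rwa [integral_const, probReal_univ, one_smul] at hmono

/-- The losses are fixed in advance, so that the comparator only enters the regret through a
deterministic summand, and the supremum over comparators commutes with the expectation. -/
lemma IsPlay.integral_bdaRegret_le [Nonempty X] {Ω : Type*} [MeasurableSpace Ω] {P : Measure Ω}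
    [IsProbabilityMeasure P] {a : ℕ → Ω → X} (h : IsPlay P ℓ η δ ε a)
    (hball : ∀ t, ∃ κ > 0, ∀ x : X, κ ≤ (leb X).real (Metric.closedBall x (δ t)))
    (hε0 : ∀ t, 0 < ε t) (hε1 : ∀ t, ε t ≤ 1) (hℓ : ∀ t, BddMeas (ℓ t))
    (hV : ∀ t x, |ℓ t x| ≤ V) (T : ℕ) {B : ℝ}
    (hB : ∀ x, ∫ ω, regretAgainst ℓ (policy ℓ η δ ε fun s => a s ω) T x ∂P ≤ B) :
    Integrable (fun ω => bdaRegret ℓ η δ ε (fun t => a t ω) T) P ∧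
      ∫ ω, bdaRegret ℓ η δ ε (fun t => a t ω) T ∂P ≤ B := by
  have hpath : Measurable fun ω s => a s ω := measurable_pi_lambda _ h.measurable
  set A : Ω → ℝ := fun ω => ∑ t ∈ Finset.range T,
    ∫ z, ℓ t z * policy ℓ η δ ε (fun s => a s ω) t z ∂(leb X) with hAdef
  set b : X → ℝ := fun x => ∑ t ∈ Finset.range T, -ℓ t x with hbdef
  have hA : BddMeas A := BddMeas.sum _ fun t _ =>
    (((hℓ t).snd.mul (bddMeas_policy hball hε0 hε1 hℓ t)).integral_right (leb X)).comp hpath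
  have hsplit : ∀ ω x, regretAgainst ℓ (policy ℓ η δ ε fun s => a s ω) T x = b x + A ω :=
    fun ω x => by
      simp only [regretAgainst, hAdef, hbdef, ← Finset.sum_add_distrib]
      exact Finset.sum_congr rfl fun t _ => by ring
  have hbdd : BddAbove (Set.range b) := by
    refine ⟨∑ _t ∈ Finset.range T, V, ?_⟩
    rintro _ ⟨x, rfl⟩
    exact Finset.sum_le_sum fun t _ => (neg_le_abs _).trans (hV t x)
  have hreg : (fun ω => bdaRegret ℓ η δ ε (fun t => a t ω) T) = fun ω => (⨆ x, b x) + A ω := by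
    funext ω
    rw [ciSup_add hbdd]
    simp only [bdaRegret, regret, hsplit]
  rw [hreg]
  refine ⟨((BddMeas.const _).add hA).integrable P, ?_⟩
  have hint : ∀ c : ℝ, ∫ ω, (c + A ω) ∂P = c + ∫ ω, A ω ∂P := fun c => by
    rw [integral_add ((BddMeas.const c).integrable P) (hA.integrable P), integral_const,
      probReal_univ, one_smul]
  simp_rw [hsplit, hint] at hB
  rw [hint]
  have : ⨆ x, b x ≤ B - ∫ ω, A ω ∂P := ciSup_le fun x => by linarith [hB x]
  linarith

end Regret

/-! ### The regret bound for polynomial parameters -/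

/-- If `p < d w + b`, the learning rates decay too slowly for the second-order analysis of Hedge,
but then the claimed rate is worse than linear. Otherwise, `η t` times the loss model stays bounded. -/
theorem boundedExpectedRegret_polyDecay.{u} {d : ℕ} {X : Set (Euc d)} (hX : IsCompact X)
    (hconv : Convex ℝ X) (hint : (interior X).Nonempty) {V L : ℝ} (hV : 0 < V) (hL : 0 < L)
    {η₀ δ₀ ε₀ : ℝ} (hη₀ : 0 < η₀) (hδ₀ : 0 < δ₀) (hε₀ : 0 < ε₀) (hε₁ : ε₀ ≤ 1)
    {p w b : ℝ} (hp : 0 ≤ p) (hw : 0 ≤ w) (hb : 0 ≤ b) :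
    BoundedExpectedRegret.{u} X V L (polyDecay η₀ p) (polyDecay δ₀ w) (polyDecay ε₀ b)
      (fun T => (T : ℝ) ^ p * (1 + Real.log T) + (T : ℝ) ^ (1 - w) + (T : ℝ) ^ (1 - b)
          + (T : ℝ) ^ (1 + d * w + b - p)) := by
  have hfin : IsFiniteMeasure (leb X) := isFiniteMeasure_leb hX
  have hne : NeZero (leb X) := ⟨leb_ne_zero hX hint⟩
  have hX0 : Nonempty X := (hint.mono interior_subset).to_subtype
  have hm : 0 < (leb X).real Set.univ := leb_real_univ_pos X
  obtain ⟨D, hD0, hD⟩ : ∃ D : ℝ, 0 < D ∧ ∀ x ∈ X, ∀ y ∈ X, dist x y ≤ D :=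
    ⟨Metric.diam X + 1, add_pos_of_nonneg_of_pos Metric.diam_nonneg one_pos, fun x hx y hy =>
      (Metric.dist_le_diam_of_mem hX.isBounded hx hy).trans (by simp)⟩
  -- the kernel ball of radius `δ₀ τ ^ (-w)` contains a copy of `X` scaled by `σ τ ^ (-w)`
  set σ : ℝ := min 1 (δ₀ / D) with hσ
  have hσ0 : 0 < σ := lt_min one_pos (div_pos hδ₀ hD0)
  set κ : ℕ → ℝ := fun t => polyDecay σ w t ^ d * (leb X).real Set.univ with hκdef
  have hκ : ∀ t, 0 < κ t := fun t => mul_pos (pow_pos (polyDecay_pos hσ0 w t) d) hm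
  have hball : ∀ t (x : X), κ t ≤ (leb X).real (Metric.closedBall x (polyDecay δ₀ w t)) := by
    intro t x
    refine pow_mul_leb_le_leb_closedBall hX hconv hD (polyDecay_pos hσ0 w t).le
      ((polyDecay_le hσ0 hw t).trans (min_le_left _ _)) ?_ x
    have h1 : σ * D ≤ δ₀ := by
      rw [← le_div_iff₀ hD0]
      exact min_le_right _ _
    calc polyDecay σ w t * D = σ * D * ((t : ℝ) + 1) ^ (-w) := by unfold polyDecay; ring
      _ ≤ polyDecay δ₀ w t :=
        mul_le_mul_of_nonneg_right h1 (Real.rpow_nonneg (by positivity) _)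
  have hball' : ∀ t, ∃ κ > 0, ∀ x : X,
      κ ≤ (leb X).real (Metric.closedBall x (polyDecay δ₀ w t)) := fun t => ⟨κ t, hκ t, hball t⟩
  have hε0 : ∀ t, 0 < polyDecay ε₀ b t := polyDecay_pos hε₀ b
  have hε1 : ∀ t, polyDecay ε₀ b t ≤ 1 := fun t => (polyDecay_le hε₀ hb t).trans hε₁
  rcases lt_or_ge p (d * w + b) with hlt | hge
  · -- here `1 + d w + b - p > 1`, and the trivial bound on the regret suffices
    refine ⟨2 * V, by positivity, fun ℓ hℓV hℓL Ω _ P _ a h T hT => ?_⟩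
    have hℓ : ∀ t, BddMeas (ℓ t) := fun t => bddMeas_of_lipschitz hL.le (hℓV t) (hℓL t)
    refine h.integral_bdaRegret_le hball' hε0 hε1 hℓ hℓV T fun x =>
      (h.integral_regretAgainst_le_trivial hball' hε0 hε1 hℓ hℓV T x).trans ?_
    refine mul_le_mul_of_nonneg_left ?_ (by positivity)
    have hT1 : (1 : ℝ) ≤ T := by exact_mod_cast hT
    have h1 : (T : ℝ) ≤ (T : ℝ) ^ (1 + d * w + b - p) :=
      Real.self_le_rpow_of_one_le hT1 (by linarith)
    have h2 : 0 ≤ (T : ℝ) ^ p * (1 + Real.log T) := by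
      have := Real.log_nonneg hT1
      positivity
    have h3 : 0 ≤ (T : ℝ) ^ (1 - w) := by positivity
    have h4 : 0 ≤ (T : ℝ) ^ (1 - b) := by positivity
    linarith
  set A : ℝ := η₀ / (σ ^ d * ε₀) with hA
  have hA0 : 0 < A := by positivity
  have hratio : ∀ t v, polyDecay η₀ p t
      * (v / (κ t * (polyDecay ε₀ b t / (leb X).real Set.univ)))
      = A * v * ((t : ℝ) + 1) ^ (-(p - d * w - b)) := by
    intro t v
    have ht : (0 : ℝ) < (t : ℝ) + 1 := by positivity
    have e : ((t : ℝ) + 1) ^ (-(p - d * w - b)) * (((t : ℝ) + 1) ^ (-w)) ^ d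
        * ((t : ℝ) + 1) ^ (-b) = ((t : ℝ) + 1) ^ (-p) := by
      rw [← Real.rpow_natCast, ← Real.rpow_mul ht.le, ← Real.rpow_add ht, ← Real.rpow_add ht]
      congr 1; ring
    have h1 : 0 < ((t : ℝ) + 1) ^ (-w) := Real.rpow_pos_of_pos ht _
    have h2 : 0 < ((t : ℝ) + 1) ^ (-b) := Real.rpow_pos_of_pos ht _
    simp only [hκdef, polyDecay, hA, ← e, mul_pow]
    field_simp
  have hM : ∀ t, polyDecay η₀ p t
      * (V / (κ t * (polyDecay ε₀ b t / (leb X).real Set.univ))) ≤ A * V := by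
    intro t
    rw [hratio]
    refine mul_le_of_le_one_right (by positivity) ?_
    exact Real.rpow_le_one_of_one_le_of_nonpos (by simp) (by linarith)
  obtain ⟨Cb, hCb, hsb⟩ := exists_sum_rpow_neg_le b
  obtain ⟨Cw, hCw, hsw⟩ := exists_sum_rpow_neg_le w
  obtain ⟨Cq, hCq, hsq⟩ := exists_sum_rpow_neg_le (p - d * w - b)
  refine ⟨d / η₀ + 2 * V * ε₀ * Cb + 2 * L * δ₀ * Cw + L * D
      + Real.exp (A * V) * (A * V ^ 2) * Cq, by positivity,
    fun ℓ hℓV hℓL Ω _ P _ a h T hT => ?_⟩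
  have hℓ : ∀ t, BddMeas (ℓ t) := fun t => bddMeas_of_lipschitz hL.le (hℓV t) (hℓL t)
  refine h.integral_bdaRegret_le hball' hε0 hε1 hℓ hℓV T fun x₀ => ?_
  obtain ⟨n, rfl⟩ : ∃ n, T = n + 1 := ⟨T - 1, by omega⟩
  have hn : (0 : ℝ) < n + 1 := by positivity
  -- the comparator `x₀` is replaced by the uniform distribution on a ball of radius `D / T`
  have hρm : (((n : ℝ) + 1)⁻¹) ^ d * (leb X).real Set.univ
      ≤ (leb X).real (Metric.closedBall x₀ (D / (n + 1))) :=
    pow_mul_leb_le_leb_closedBall hX hconv hD (inv_pos.2 hn).le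
      (inv_le_one_of_one_le₀ (by simp)) (by rw [div_eq_inv_mul]) x₀
  have hρ : 0 < (leb X).real (Metric.closedBall x₀ (D / (n + 1))) :=
    (mul_pos (pow_pos (inv_pos.2 hn) d) hm).trans_le hρm
  refine (h.integral_regretAgainst_le hκ hball hε0 hε1 (polyDecay_pos hη₀ p)
    (polyDecay_antitone hη₀ hp) hℓ hℓV hL.le hℓL hM hρ n).trans ?_
  have hent : Real.log ((leb X).real Set.univ
      / (leb X).real (Metric.closedBall x₀ (D / (n + 1)))) ≤ d * Real.log (n + 1) := by
    rw [← Real.log_pow]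
    refine Real.log_le_log (div_pos hm hρ) ?_
    rw [div_le_iff₀ hρ]
    calc (leb X).real Set.univ
        = ((n : ℝ) + 1) ^ d * ((((n : ℝ) + 1)⁻¹) ^ d * (leb X).real Set.univ) := by
          rw [← mul_assoc, ← mul_pow, mul_inv_cancel₀ hn.ne', one_pow, one_mul]
      _ ≤ _ := mul_le_mul_of_nonneg_left hρm (by positivity)
  have hterm : ∀ t, 2 * V * polyDecay ε₀ b t + 2 * (L * polyDecay δ₀ w t) + L * (D / (n + 1))
      + Real.exp (A * V) * polyDecay η₀ p t
        * (V ^ 2 / (κ t * (polyDecay ε₀ b t / (leb X).real Set.univ)))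
      = 2 * V * ε₀ * ((t : ℝ) + 1) ^ (-b) + 2 * L * δ₀ * ((t : ℝ) + 1) ^ (-w)
        + L * (D / (n + 1))
        + Real.exp (A * V) * (A * V ^ 2) * ((t : ℝ) + 1) ^ (-(p - d * w - b)) := fun t => by
    rw [mul_assoc (Real.exp _), hratio]
    unfold polyDecay
    ring
  simp_rw [hterm]
  rw [Finset.sum_add_distrib, Finset.sum_add_distrib, Finset.sum_add_distrib, ← Finset.mul_sum,
    ← Finset.mul_sum, ← Finset.mul_sum _ _ (Real.exp (A * V) * (A * V ^ 2)), Finset.sum_const,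
    Finset.card_range, nsmul_eq_mul]
  have hsb := hsb (n + 1) hT
  have hsw := hsw (n + 1) hT
  have hsq := hsq (n + 1) hT
  rw [show 1 - (p - d * w - b) = 1 + d * w + b - p by ring] at hsq
  push_cast at hsb hsw hsq ⊢
  set lg := Real.log ((n : ℝ) + 1) with hlg
  have hlg0 : 0 ≤ lg := Real.log_nonneg (by simp)
  set Tp := ((n : ℝ) + 1) ^ p with hTp
  have hTp1 : 1 ≤ Tp := Real.one_le_rpow (by simp) hp
  set Tw := ((n : ℝ) + 1) ^ (1 - w)
  set Tb := ((n : ℝ) + 1) ^ (1 - b)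
  set Tq := ((n : ℝ) + 1) ^ (1 + d * w + b - p)
  have hTw : 0 ≤ Tw := Real.rpow_nonneg hn.le _
  have hTb : 0 ≤ Tb := Real.rpow_nonneg hn.le _
  have hTq : 0 ≤ Tq := Real.rpow_nonneg hn.le _
  set F := Tp * (1 + lg) + Tw + Tb + Tq with hF
  have hbase : 1 + lg ≤ Tp * (1 + lg) := le_mul_of_one_le_left (by linarith) hTp1
  have hF1 : Real.log ((leb X).real Set.univ
      / (leb X).real (Metric.closedBall x₀ (D / (n + 1)))) / polyDecay η₀ p n ≤ d / η₀ * F := by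
    have e : d * lg / polyDecay η₀ p n = d / η₀ * (Tp * lg) := by
      unfold polyDecay
      rw [Real.rpow_neg hn.le, ← hTp]
      field_simp
    refine (div_le_div_of_nonneg_right hent (polyDecay_pos hη₀ p n).le).trans ?_
    rw [e]
    exact mul_le_mul_of_nonneg_left (by nlinarith) (by positivity)
  have hF2 : 2 * V * ε₀ * ∑ t ∈ Finset.range (n + 1), ((t : ℝ) + 1) ^ (-b)
      ≤ 2 * V * ε₀ * Cb * F := by
    rw [mul_assoc _ Cb]
    refine mul_le_mul_of_nonneg_left (hsb.trans ?_) (by positivity)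
    exact mul_le_mul_of_nonneg_left (by linarith) hCb.le
  have hF3 : 2 * L * δ₀ * ∑ t ∈ Finset.range (n + 1), ((t : ℝ) + 1) ^ (-w)
      ≤ 2 * L * δ₀ * Cw * F := by
    rw [mul_assoc _ Cw]
    refine mul_le_mul_of_nonneg_left (hsw.trans ?_) (by positivity)
    exact mul_le_mul_of_nonneg_left (by linarith) hCw.le
  have hF4 : ((n : ℝ) + 1) * (L * (D / (n + 1))) ≤ L * D * F := by
    rw [show ((n : ℝ) + 1) * (L * (D / (n + 1))) = L * D by field_simp]
    exact le_mul_of_one_le_right (by positivity) (by linarith)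
  have hF5 : Real.exp (A * V) * (A * V ^ 2)
      * ∑ t ∈ Finset.range (n + 1), ((t : ℝ) + 1) ^ (-(p - d * w - b))
      ≤ Real.exp (A * V) * (A * V ^ 2) * Cq * F := by
    rw [mul_assoc _ Cq]
    refine mul_le_mul_of_nonneg_left (hsq.trans ?_) (by positivity)
    exact mul_le_mul_of_nonneg_left (by linarith) hCq.le
  linarith

/-- A regret bound implies every other regret bound that dominates it up to a constant. -/
lemma BoundedExpectedRegret.mono.{u} {d : ℕ} {X : Set (Euc d)} {V L : ℝ} {η δ ε F G : ℕ → ℝ}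
    (h : BoundedExpectedRegret.{u} X V L η δ ε F) {c : ℝ} (hc : 0 < c)
    (hFG : ∀ T : ℕ, 1 ≤ T → F T ≤ c * G T) : BoundedExpectedRegret.{u} X V L η δ ε G := by
  obtain ⟨K, hK, hreg⟩ := h
  refine ⟨K * c, mul_pos hK hc, fun ℓ hℓV hℓL Ω _ P _ a hplay T hT => ?_⟩
  obtain ⟨hi, hle⟩ := hreg ℓ hℓV hℓL Ω P a hplay T hT
  refine ⟨hi, hle.trans ?_⟩
  rw [mul_assoc]
  exact mul_le_mul_of_nonneg_left (hFG T hT) hK.le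

end BanditDA

theorem mainTheorem3 (d : ℕ) (X : Set (EuclideanSpace ℝ (Fin d)))
    (hXcompact : IsCompact X) (hXconvex : Convex ℝ X) (hXint : (interior X).Nonempty)
    (V L : ℝ) (hV : 0 < V) (hL : 0 < L)
    (η₀ δ₀ ε₀ : ℝ) (hη₀ : 0 < η₀) (hδ₀ : 0 < δ₀) (hε₀ : 0 < ε₀) (hε₁ : ε₀ ≤ 1) :
    (∀ p w b : ℝ, 0 ≤ p → 0 ≤ w → 0 ≤ b →
      BanditDA.BoundedExpectedRegret X V L
        (BanditDA.polyDecay η₀ p) (BanditDA.polyDecay δ₀ w) (BanditDA.polyDecay ε₀ b)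
        (fun T => (T : ℝ) ^ p * (1 + Real.log T) + (T : ℝ) ^ (1 - w) + (T : ℝ) ^ (1 - b)
          + (T : ℝ) ^ (1 + d * w + b - p))) ∧
    BanditDA.BoundedExpectedRegret X V L
      (BanditDA.polyDecay η₀ (((d : ℝ) + 2) / (d + 3)))
      (BanditDA.polyDecay δ₀ (1 / ((d : ℝ) + 3)))
      (BanditDA.polyDecay ε₀ (1 / ((d : ℝ) + 3)))
      (fun T => (T : ℝ) ^ (((d : ℝ) + 2) / (d + 3)) * (1 + Real.log T)) := by
  refine ⟨fun p w b hp hw hb => BanditDA.boundedExpectedRegret_polyDecay hXcompact hXconvex hXint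
    hV hL hη₀ hδ₀ hε₀ hε₁ hp hw hb, ?_⟩
  refine (BanditDA.boundedExpectedRegret_polyDecay hXcompact hXconvex hXint
    hV hL hη₀ hδ₀ hε₀ hε₁ (by positivity) (by positivity) (by positivity)).mono four_pos
    fun T hT => ?_
  -- with these parameters, all four exponents are equal to `(d + 2) / (d + 3)`
  have hd : (d : ℝ) + 3 ≠ 0 := by positivity
  have e1 : 1 - 1 / ((d : ℝ) + 3) = ((d : ℝ) + 2) / (d + 3) := by field_simp; ring
  have e2 : 1 + d * (1 / ((d : ℝ) + 3)) + 1 / ((d : ℝ) + 3) - ((d : ℝ) + 2) / (d + 3)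
      = ((d : ℝ) + 2) / (d + 3) := by field_simp; ring
  rw [e1, e2]
  have hlog : 0 ≤ Real.log T := Real.log_nonneg (by exact_mod_cast hT)
  have hpow : 0 ≤ (T : ℝ) ^ (((d : ℝ) + 2) / (d + 3)) := by positivity
  linarith [mul_nonneg hpow hlog]
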